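/- Let $(\mathcal B,\|\cdot\|_{\mathcal B})$ and $(\mathcal A,\|\cdot\|_{\mathcal A})$ be complex Banach spaces with $\mathcal B\subset\mathcal A$ and $\|\cdot\|_{\mathcal A}\le\|\cdot\|_{\mathcal B}$ on $\mathcal B$. Let $(T_t)_{t\ge 0}$ be a bounded one-parameter semigroup of bounded linear operators on $\mathcal B$: $T_0=\mathrm{Id}$, $T_sT_t=T_{s+t}$, and $\sup_{t\ge0}\|T_t\|_{\mathcal B}<\infty$. Strong continuity is not assumed; only that the orbits $t\mapsto T_t\mu\in\mathcal B$ are strongly measurable, so that for $\operatorname{Re} z>0$ the Bochner integrals $R(z)\mu=\int_0^\infty e^{-zt}T_t\mu\,dt$ $(\mu\in\mathcal B)$ define a bounded operator $R(z)$ on $\mathcal B$. Let $Z\mu=\lim_{t\to0^+}\frac1t(T_t\mu-\mu)$ be the generator, with domain $\operatorname{Dom}(Z)$ the set of $\mu\in\mathcal B$ for which the limit exists in $\mathcal B$. Suppose that: (1) (Weak-Lipschitz) there is $C>0$ with $\frac1t\|T_t-\mathrm{Id}\|_{\mathcal B\to\mathcal A}\le C$ for all $t>0$; (2) (Lasota–Yorke)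 $\lambda>0$ and, for all $\operatorname{Re} z>0$, the essential spectral radius of $R(z):\mathcal B\to\mathcal B$ is at most $(\operatorname{Re} z+\lambda)^{-1}$; (3) (Rapid) $\beta>0$ and there are $C,c,c'>0$ such that $R$ admits a holomorphic extension to $\{z\in\mathbb C:|\operatorname{Im} z|\ge\beta,\ \operatorname{Re} z\ge-|\operatorname{Im} z|^{-c}\}$, with $\|R(z)\|_{\mathcal B}\le C|\operatorname{Im} z|^{c'}$ on this set. Then there exist a finite set $\{z_j\}_{j=1}^N\subset\{z\in\mathbb C:-\lambda<\operatorname{Re} z\le0,\ |\operatorname{Im} z|\le\beta\}$, finite-rank projectors $\Pi_1,\dots,\Pi_N$ in the space of bounded operators on $\mathcal B$, and bounded operators $P_t:\mathcal B\to\mathcal B$ $(t\ge0)$ such that $$T_t=P_t+\sum_{j=1}^N e^{tz_j}\Pi_j\qquad\text{for all }t\ge0.$$ Moreover, for every $p\in\mathbb N$ there exist $q\in\mathbb N$ and $C_p>0$ such that, for all $\mu\in\operatorname{Dom}(Z^q)$ and $t\ge0$, $$t^p\,\|P_t\mu\|_{\mathcal A}\le C_p\sum_{0\le n\le q}\|Z^n\mu\|_{\mathcal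 B}.$$ -/

import Mathlib

open Filter Topology MeasureTheory
open scoped ENNReal

noncomputable section

/-- A bounded one-parameter semigroup `T t : B → B`, `t ≥ 0`, of bounded linear operators on a
complex Banach space. Only the values at `t ≥ 0` matter. No continuity in `t` is required: the
orbits are only supposed to be measurable for the norm of `B`, which (the semigroup being bounded)
says exactly that the Bochner integrals `∫₀^∞ e^{-zt} T t μ dt` exist in `B` for `Re z > 0`. -/
structure BoundedSemigroup (B : Type*) [NormedAddCommGroup B] [NormedSpace ℂ B] where
  T : ℝ → B →L[ℂ] B
  map_zero : T 0 = ContinuousLinearMap.id ℂ B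
  map_add : ∀ s t : ℝ, 0 ≤ s → 0 ≤ t → (T s).comp (T t) = T (s + t)
  bounded : ∃ C : ℝ, 0 < C ∧ ∀ t : ℝ, 0 ≤ t → ‖T t‖ ≤ C
  measurable : ∀ μ : B, AEStronglyMeasurable (fun t : ℝ => T t μ) (volume.restrict (Set.Ioi 0))

namespace BoundedSemigroup

variable {A B : Type*} [NormedAddCommGroup A] [NormedSpace ℂ A]
  [NormedAddCommGroup B] [NormedSpace ℂ B]

/-- The integrand `e^{-zt} T t μ` of the Laplace transform. -/
def integrand (S : BoundedSemigroup B) (z : ℂ) (μ : B) (t : ℝ) : B :=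
  Complex.exp (-z * (t : ℂ)) • S.T t μ

lemma norm_integrand_le (S : BoundedSemigroup B) {C : ℝ} (hC : ∀ t : ℝ, 0 ≤ t → ‖S.T t‖ ≤ C)
    (z : ℂ) (μ : B) {t : ℝ} (ht : 0 ≤ t) :
    ‖S.integrand z μ t‖ ≤ Real.exp (-z.re * t) * (C * ‖μ‖) := by
  have h1 : ‖Complex.exp (-z * (t : ℂ))‖ = Real.exp (-z.re * t) := by
    rw [Complex.norm_exp]; simp
  rw [integrand, norm_smul, h1]
  gcongr
  exact (S.T t).le_of_opNorm_le (hC t ht) μ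

lemma integrable_bound {a : ℝ} (ha : 0 < a) (K : ℝ) :
    Integrable (fun t : ℝ => Real.exp (-a * t) * K) (volume.restrict (Set.Ioi 0)) :=
  ((integrableOn_exp_mul_Ioi (neg_lt_zero.mpr ha) 0 : IntegrableOn _ _ _) : Integrable _ _).mul_const K

lemma integrable_integrand (S : BoundedSemigroup B) {z : ℂ} (hz : 0 < z.re) (μ : B) :
    Integrable (S.integrand z μ) (volume.restrict (Set.Ioi 0)) := by
  obtain ⟨C, -, hC⟩ := S.bounded
  refine (integrable_bound hz (C * ‖μ‖)).mono' ?_ ?_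
  · exact (Continuous.aestronglyMeasurable (by fun_prop)).smul (S.measurable μ)
  · filter_upwards [ae_restrict_mem measurableSet_Ioi] with t ht
    exact S.norm_integrand_le hC z μ (le_of_lt ht)

/-- The Laplace transform `R(z) = ∫₀^∞ e^{-zt} T t dt` as a bounded operator on `B`, for
`Re z > 0` (and `0`, by convention, for other `z`). -/
def R (S : BoundedSemigroup B) (z : ℂ) : B →L[ℂ] B :=
  open Classical in
  if hz : 0 < z.re then
    LinearMap.mkContinuousOfExistsBound
      { toFun := fun μ => ∫ t in Set.Ioi (0 : ℝ), S.integrand z μ t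
        map_add' := fun μ ν => by
          rw [← integral_add (S.integrable_integrand hz μ) (S.integrable_integrand hz ν)]
          simp [integrand]
        map_smul' := fun c μ => by
          rw [RingHom.id_apply, ← integral_smul]
          simp [integrand, smul_comm c] }
      (by
        obtain ⟨C, -, hC⟩ := S.bounded
        refine ⟨∫ t in Set.Ioi (0 : ℝ), Real.exp (-z.re * t) * C, fun μ => ?_⟩
        rw [← integral_mul_const]
        refine norm_integral_le_of_norm_le ?_ ?_
        · exact (integrable_bound hz C).mul_const _
        · filter_upwards [ae_restrict_mem measurableSet_Ioi] with t ht
          rw [mul_assoc]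
          exact S.norm_integrand_le hC z μ (le_of_lt ht))
  else 0

lemma R_apply (S : BoundedSemigroup B) {z : ℂ} (hz : 0 < z.re) (μ : B) :
    S.R z μ = ∫ t in Set.Ioi (0 : ℝ), Complex.exp (-z * (t : ℂ)) • S.T t μ := by
  rw [R, dif_pos hz]; rfl

/-- The domain of the generator: all `μ` for which `t⁻¹ (T t μ - μ)` converges in `B`
as `t → 0`, `t > 0`. -/
def genDom (S : BoundedSemigroup B) : Set B :=
  {μ | ∃ ν : B, Tendsto (fun t : ℝ => (t⁻¹ : ℝ) • (S.T t μ - μ)) (𝓝[>] 0) (𝓝 ν)}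

/-- The generator `Z μ = lim_{t → 0} t⁻¹ (T t μ - μ)`; meaningful for `μ ∈ S.genDom`. -/
def gen (S : BoundedSemigroup B) (μ : B) : B :=
  limUnder (𝓝[>] (0 : ℝ)) (fun t : ℝ => (t⁻¹ : ℝ) • (S.T t μ - μ))

/-- `Dom(Z^q)`: the vectors `μ` such that `μ, Z μ, …, Z^{q-1} μ` all belong to `Dom(Z)`. -/
def genPowDom (S : BoundedSemigroup B) (q : ℕ) : Set B :=
  {μ | ∀ n < q, S.gen^[n] μ ∈ S.genDom}

/-- The norm `∑_{0 ≤ n ≤ q} ‖Z^n μ‖` of `μ ∈ Dom(Z^q)`. -/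
def genPowNorm (S : BoundedSemigroup B) (q : ℕ) (μ : B) : ℝ :=
  ∑ n ∈ Finset.range (q + 1), ‖S.gen^[n] μ‖

/-- Weak-Lipschitz assumption, `A ⊇ B` being given through the inclusion `ι`:
`t⁻¹ ‖T t - Id‖_{B → A}` is bounded. -/
def WeakLipschitz (S : BoundedSemigroup B) (ι : B →L[ℂ] A) : Prop :=
  ∃ C : ℝ, 0 < C ∧
    ∀ t : ℝ, 0 ≤ t → 1 / t * ‖ι.comp (S.T t - ContinuousLinearMap.id ℂ B)‖ ≤ C

end BoundedSemigroup

/-- `η` is an isolated eigenvalue of `L` of finite algebraic multiplicity: an isolated point of the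
spectrum for which there is a finite-rank spectral projection `P`, i.e. `P` commutes with `L`,
`η - L` is nilpotent on the range of `P` and invertible on the kernel of `P`. -/
def IsDiscreteEigenvalue {B : Type*} [NormedAddCommGroup B] [NormedSpace ℂ B]
    (L : B →L[ℂ] B) (η : ℂ) : Prop :=
  η ∈ spectrum ℂ L ∧
  (∃ r : ℝ, 0 < r ∧ ∀ ζ : ℂ, ζ ≠ η → ‖ζ - η‖ < r → ζ ∉ spectrum ℂ L) ∧
  ∃ P : B →L[ℂ] B, P * P = P ∧ FiniteDimensional ℂ (LinearMap.range P.toLinearMap) ∧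
    P * L = L * P ∧
    (∃ n : ℕ, ∀ μ : B, P μ = μ → ((η • (1 : B →L[ℂ] B) - L) ^ n) μ = 0) ∧
    Set.BijOn (fun μ : B => η • μ - L μ) {μ | P μ = 0} {μ | P μ = 0}

/-- The essential spectrum: the spectrum without the isolated eigenvalues of finite algebraic
multiplicity. -/
def essSpectrum {B : Type*} [NormedAddCommGroup B] [NormedSpace ℂ B]
    (L : B →L[ℂ] B) : Set ℂ :=
  {η | η ∈ spectrum ℂ L ∧ ¬ IsDiscreteEigenvalue L η}

/-- The essential spectral radius. -/
def essSpectralRadius {B : Type*} [NormedAddCommGroup B] [NormedSpace ℂ B]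
    (L : B →L[ℂ] B) : ℝ≥0∞ :=
  ⨆ η ∈ essSpectrum L, (‖η‖₊ : ℝ≥0∞)

namespace BoundedSemigroup

variable {B : Type*} [NormedAddCommGroup B] [NormedSpace ℂ B]

/-- Lasota–Yorke assumption with constant `lam`: the essential spectral radius of `R(z)` is at most
`(Re z + lam)⁻¹` for all `Re z > 0`. -/
def LasotaYorke (S : BoundedSemigroup B) (lam : ℝ) : Prop :=
  ∀ z : ℂ, 0 < z.re → essSpectralRadius (S.R z) ≤ ENNReal.ofReal ((z.re + lam)⁻¹)

/-- The set `{|Im z| ≥ β, Re z ≥ -|Im z|^{-c}}`. -/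
def rapidRegion (β c : ℝ) : Set ℂ :=
  {z | β ≤ |z.im| ∧ -(|z.im| ^ (-c)) ≤ z.re}

/-- Rapid-mixing assumption with constant `β`: for some `C, c', c > 0`, `R` has a holomorphic
extension `F` to `{|Im z| ≥ β, Re z ≥ -|Im z|^{-c}}`, with `‖F z‖ ≤ C |Im z|^{c'}` there. (At
boundary points of this closed set only differentiability within the set is asked.) -/
def RapidMixing (S : BoundedSemigroup B) (β : ℝ) : Prop :=
  ∃ C c' c : ℝ, 0 < C ∧ 0 < c' ∧ 0 < c ∧ ∃ F : ℂ → B →L[ℂ] B,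
    (∀ z ∈ rapidRegion β c, 0 < z.re → F z = S.R z) ∧
    DifferentiableOn ℂ F (rapidRegion β c) ∧
    ∀ z ∈ rapidRegion β c, ‖F z‖ ≤ C * |z.im| ^ c'

end BoundedSemigroup

end

noncomputable section

/-! ### Orbits, Laplace transform and generator without strong continuity -/

namespace BoundedSemigroup

variable {B : Type*} [NormedAddCommGroup B] [NormedSpace ℂ B]

/-! Only the poles of `R` on the imaginary axis need to be removed: all `z j` are imaginary, and any
slower or faster decay is left in `P t = T t - ∑ e^{t z j} Q j`.

For `z₀` on the axis and `a > 0` large, Lasota–Yorke puts `(a - z₀)⁻¹` outside the essential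
spectrum of `R(a)`. The resolvent identity then turns the finite-rank spectral projection of `R(a)`
into a pole of `R` at `z₀`; the bound `‖R(z)‖ ≤ C / Re z` makes it simple, and its residue is a
finite-rank projector (`exists_simple_pole_of_notMem_essSpectrum`). Poles are isolated and rapid
mixing excludes them for `|Im z| ≥ β`, so they are finitely many (`exists_finite_principal_parts`).

The Laplace transform of `P t μ` is `regularPart`, and its `p`-th derivative is the transform of
`(-t)^p P t μ`. Near a compact piece of the axis this derivative is bounded, by analyticity. At
height `y` one expands `R(w) μ` in powers of `w⁻¹`, with remainder `w⁻ⁿ R(w) Zⁿ μ`; Cauchy's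
estimate in the rapid-mixing region loses only a power of `y`, so a large `n` gives `O(y⁻²)`
(`norm_iteratedDeriv_regularPart_le_of_rapid`). Fourier inversion on `Re w = a`, with bounds uniform
as `a → 0+`, bounds `t^p ‖P t μ‖` in `B` (`exists_pow_mul_norm_le`), hence in `A`. -/

lemma T_T_apply (S : BoundedSemigroup B) {s t : ℝ} (hs : 0 ≤ s) (ht : 0 ≤ t) (μ : B) :
    S.T s (S.T t μ) = S.T (s + t) μ := by
  rw [← S.map_add s t hs ht]; rfl

lemma T_zero_apply (S : BoundedSemigroup B) (μ : B) : S.T 0 μ = μ := by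
  rw [S.map_zero]; rfl

lemma T_comm_apply (S : BoundedSemigroup B) {s t : ℝ} (hs : 0 ≤ s) (ht : 0 ≤ t) (μ : B) :
    S.T s (S.T t μ) = S.T t (S.T s μ) := by
  rw [S.T_T_apply hs ht, S.T_T_apply ht hs, add_comm]

lemma intervalIntegrable_integrand (S : BoundedSemigroup B) {z : ℂ} (hz : 0 < z.re) (μ : B)
    {h : ℝ} (hh : 0 ≤ h) : IntervalIntegrable (S.integrand z μ) volume 0 h := by
  rw [intervalIntegrable_iff_integrableOn_Ioc_of_le hh]
  exact IntegrableOn.mono_set (S.integrable_integrand hz μ) Set.Ioc_subset_Ioi_self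

lemma integrand_zero (S : BoundedSemigroup B) (z : ℂ) (μ : B) : S.integrand z μ 0 = μ := by
  simp [integrand, S.T_zero_apply]

lemma tendsto_T_of_tendsto_slope (S : BoundedSemigroup B) {μ ν : B}
    (h : Tendsto (fun t : ℝ => (t⁻¹ : ℝ) • (S.T t μ - μ)) (𝓝[>] 0) (𝓝 ν)) :
    Tendsto (fun t => S.T t μ) (𝓝[>] 0) (𝓝 μ) := by
  have h0 : Tendsto (fun t : ℝ => t) (𝓝[>] 0) (𝓝 0) := tendsto_id.mono_left nhdsWithin_le_nhds
  have h1 := (h0.smul h).add_const μ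
  rw [zero_smul, zero_add] at h1
  refine h1.congr' ?_
  filter_upwards [self_mem_nhdsWithin] with t ht
  rw [smul_smul, mul_inv_cancel₀ (ne_of_gt ht), one_smul, sub_add_cancel]

lemma tendsto_T_of_mem_genDom (S : BoundedSemigroup B) {μ : B} (h : μ ∈ S.genDom) :
    Tendsto (fun t => S.T t μ) (𝓝[>] 0) (𝓝 μ) :=
  let ⟨_, hν⟩ := h; S.tendsto_T_of_tendsto_slope hν

lemma tendsto_gen (S : BoundedSemigroup B) {μ : B} (h : μ ∈ S.genDom) :
    Tendsto (fun t : ℝ => (t⁻¹ : ℝ) • (S.T t μ - μ)) (𝓝[>] 0) (𝓝 (S.gen μ)) :=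
  tendsto_nhds_limUnder h

/-- Boundedness gives `‖T s μ - T t μ‖ ≤ C ‖T |s-t| μ - μ‖`, so right continuity at `0` spreads to
the whole orbit. This replaces strong continuity, one vector at a time. -/
lemma continuousOn_T_apply (S : BoundedSemigroup B) {μ : B}
    (h : Tendsto (fun t => S.T t μ) (𝓝[>] 0) (𝓝 μ)) :
    ContinuousOn (fun t => S.T t μ) (Set.Ici 0) := by
  obtain ⟨C, hC, hCb⟩ := S.bounded
  have key : ∀ s t : ℝ, 0 ≤ s → 0 ≤ t → ‖S.T s μ - S.T t μ‖ ≤ C * ‖S.T |s - t| μ - μ‖ := by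
    have aux : ∀ s t : ℝ, 0 ≤ s → s ≤ t → ‖S.T s μ - S.T t μ‖ ≤ C * ‖S.T |s - t| μ - μ‖ := by
      intro s t hs hst
      have h1 : S.T t μ = S.T s (S.T |s - t| μ) := by
        rw [S.T_T_apply hs (abs_nonneg _), abs_sub_comm, abs_of_nonneg (sub_nonneg.2 hst)]
        congr 2; ring
      rw [h1, norm_sub_rev, ← map_sub]
      exact (S.T s).le_of_opNorm_le (hCb s hs) _
    intro s t hs ht
    rcases le_total s t with hst | hst
    · exact aux s t hs hst
    · rw [norm_sub_rev, abs_sub_comm]; exact aux t s ht hst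
  intro t ht
  have h' : Tendsto (fun t => S.T t μ) (𝓝[≥] 0) (𝓝 μ) := by
    have h0 : ContinuousWithinAt (fun t => S.T t μ) (Set.Ioi 0) 0 := by
      rw [ContinuousWithinAt, S.T_zero_apply]; exact h
    have h1 := continuousWithinAt_Ioi_iff_Ici.1 h0
    rw [ContinuousWithinAt, S.T_zero_apply] at h1
    exact h1
  have h2 : Tendsto (fun s => |s - t|) (𝓝[≥] t ⊔ 𝓝[Set.Ici 0] t) (𝓝[≥] 0) := by
    refine tendsto_nhdsWithin_of_tendsto_nhds_of_eventually_within _ ?_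
      (Eventually.of_forall fun s => Set.mem_Ici.2 (abs_nonneg _))
    have : Continuous fun s : ℝ => |s - t| := by fun_prop
    simpa using (this.tendsto t).mono_left (sup_le nhdsWithin_le_nhds nhdsWithin_le_nhds)
  have h3 := ((h'.comp (h2.mono_left le_sup_right)).sub_const μ).norm.const_mul C
  simp only [sub_self, norm_zero, mul_zero] at h3
  rw [ContinuousWithinAt, tendsto_iff_norm_sub_tendsto_zero]
  refine squeeze_zero' (Eventually.of_forall fun _ => norm_nonneg _) ?_ h3
  filter_upwards [self_mem_nhdsWithin] with s hs
  exact key s t hs ht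

lemma exists_norm_R_le (S : BoundedSemigroup B) :
    ∃ C : ℝ, ∀ z : ℂ, 0 < z.re → ‖S.R z‖ ≤ C / z.re := by
  obtain ⟨C, hC, hCb⟩ := S.bounded
  refine ⟨C, fun z hz => ContinuousLinearMap.opNorm_le_bound _ (by positivity) fun μ => ?_⟩
  have h1 : ∫ t in Set.Ioi (0 : ℝ), Real.exp (-z.re * t) * (C * ‖μ‖) = C / z.re * ‖μ‖ := by
    rw [integral_mul_const, integral_exp_mul_Ioi (neg_lt_zero.mpr hz)]
    simp; ring
  rw [S.R_apply hz, ← h1]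
  refine norm_integral_le_of_norm_le (integrable_bound hz _) ?_
  filter_upwards [ae_restrict_mem measurableSet_Ioi] with t ht
  exact S.norm_integrand_le hCb z μ (le_of_lt ht)

variable [CompleteSpace B]

lemma map_R_apply (S : BoundedSemigroup B) {z : ℂ} (hz : 0 < z.re) (L : B →L[ℂ] B) (μ : B) :
    L (S.R z μ) = ∫ t in Set.Ioi (0 : ℝ), Complex.exp (-z * (t : ℂ)) • L (S.T t μ) := by
  rw [S.R_apply hz]
  have h := L.integral_comp_comm (S.integrable_integrand hz μ)
  simp only [integrand, map_smul] at h
  exact h.symm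

lemma R_T_apply (S : BoundedSemigroup B) {z : ℂ} (hz : 0 < z.re) {h : ℝ} (hh : 0 ≤ h) (μ : B) :
    S.R z (S.T h μ) = S.T h (S.R z μ) := by
  rw [S.map_R_apply hz, S.R_apply hz]
  refine setIntegral_congr_fun measurableSet_Ioi fun t ht => ?_
  simp only [S.T_comm_apply hh (le_of_lt ht)]

lemma R_R_apply_comm (S : BoundedSemigroup B) {z a : ℂ} (hz : 0 < z.re) (ha : 0 < a.re) (μ : B) :
    S.R z (S.R a μ) = S.R a (S.R z μ) := by
  rw [S.map_R_apply ha, S.R_apply ha]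
  refine setIntegral_congr_fun measurableSet_Ioi fun t ht => ?_
  simp only [S.R_T_apply hz (le_of_lt ht)]

/-- The action of the semigroup on the range of the Laplace transform. -/
lemma T_R_apply (S : BoundedSemigroup B) {z : ℂ} (hz : 0 < z.re) {h : ℝ} (hh : 0 ≤ h) (μ : B) :
    S.T h (S.R z μ) =
      Complex.exp (z * h) • (S.R z μ - ∫ t in (0 : ℝ)..h, S.integrand z μ t) := by
  have h1 : S.R z μ - ∫ t in (0 : ℝ)..h, S.integrand z μ t
      = ∫ t in Set.Ioi h, S.integrand z μ t := by
    rw [S.R_apply hz, sub_eq_iff_eq_add']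
    exact (intervalIntegral.integral_interval_add_Ioi (S.integrable_integrand hz μ)
      (IntegrableOn.mono_set (S.integrable_integrand hz μ) (Set.Ioi_subset_Ioi hh))).symm
  have h2 := (measurePreserving_add_right volume h).setIntegral_preimage_emb
    (measurableEmbedding_addRight h) (S.integrand z μ) (Set.Ioi h)
  have h3 : (fun x => x + h) ⁻¹' Set.Ioi h = Set.Ioi 0 := by ext; simp
  rw [h3] at h2
  rw [h1, ← h2, ← integral_smul, S.map_R_apply hz]
  refine setIntegral_congr_fun measurableSet_Ioi fun t ht => ?_
  simp only [integrand, S.T_T_apply hh (le_of_lt ht), smul_smul, ← Complex.exp_add]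
  rw [add_comm h t]
  congr 2
  push_cast; ring

lemma hasDerivWithinAt_integral_integrand (S : BoundedSemigroup B) {z : ℂ} (hz : 0 < z.re) {μ : B}
    (hμ : Tendsto (fun t => S.T t μ) (𝓝[>] 0) (𝓝 μ)) :
    HasDerivWithinAt (fun h => ∫ t in (0 : ℝ)..h, S.integrand z μ t) μ (Set.Ici 0) 0 := by
  have hc : ContinuousWithinAt (S.integrand z μ) (Set.Ioi 0) 0 := by
    rw [ContinuousWithinAt, S.integrand_zero]
    have : Tendsto (fun t : ℝ => Complex.exp (-z * (t : ℂ))) (𝓝[>] 0) (𝓝 1) := by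
      have : Continuous (fun t : ℝ => Complex.exp (-z * (t : ℂ))) := by fun_prop
      simpa using (this.tendsto 0).mono_left nhdsWithin_le_nhds
    have h := this.smul hμ
    rwa [one_smul] at h
  have := intervalIntegral.integral_hasDerivWithinAt_right (a := 0) (b := 0)
    (f := S.integrand z μ) IntervalIntegrable.refl (s := Set.Ici 0) (t := Set.Ioi 0)
    ⟨_, self_mem_nhdsWithin, (S.integrable_integrand hz μ).aestronglyMeasurable⟩ hc
  rwa [S.integrand_zero] at this

/-- `R(z) ν` lies in the domain of the generator, which acts there as `z R(z) - 1`, as soon as the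
orbit of `ν` is continuous at `0`. -/
lemma tendsto_slope_R (S : BoundedSemigroup B) {z : ℂ} (hz : 0 < z.re) {ν : B}
    (hν : Tendsto (fun t => S.T t ν) (𝓝[>] 0) (𝓝 ν)) :
    Tendsto (fun t : ℝ => (t⁻¹ : ℝ) • (S.T t (S.R z ν) - S.R z ν)) (𝓝[>] 0)
      (𝓝 (z • S.R z ν - ν)) := by
  have he : HasDerivAt (fun h : ℝ => Complex.exp (z * h)) z 0 := by
    have h1 : HasDerivAt (fun h : ℝ => z * (h : ℂ)) z 0 := by
      simpa using (Complex.ofRealCLM.hasDerivAt (x := 0)).const_mul z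
    simpa using h1.cexp
  have h2 := (he.hasDerivWithinAt (s := Set.Ici 0)).smul
    ((S.hasDerivWithinAt_integral_integrand hz hν).const_sub (S.R z ν))
  have h3 := hasDerivWithinAt_iff_tendsto_slope.mp h2
  rw [Set.Ici_sdiff_left] at h3
  simp only [Complex.ofReal_zero, mul_zero, Complex.exp_zero, intervalIntegral.integral_same,
    sub_zero, one_smul] at h3
  rw [show z • S.R z ν - ν = -ν + z • S.R z ν by abel]
  refine h3.congr' ?_
  filter_upwards [self_mem_nhdsWithin] with t ht
  rw [slope_def_module, S.T_R_apply hz (le_of_lt ht)]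
  simp

/-- By `T_R_apply`, only a primitive of an integrable function depends on time. So the range of `R`
has continuous orbits although `μ` itself need not, and `tendsto_slope_R` applies to products of two
Laplace transforms. -/
lemma tendsto_T_R (S : BoundedSemigroup B) {z : ℂ} (hz : 0 < z.re) (μ : B) :
    Tendsto (fun t => S.T t (S.R z μ)) (𝓝[>] 0) (𝓝 (S.R z μ)) := by
  have h1 : Tendsto (fun h : ℝ => ∫ t in (0 : ℝ)..h, S.integrand z μ t) (𝓝[>] 0) (𝓝 0) := by
    have hc := intervalIntegral.continuousOn_primitive_interval'
      (S.intervalIntegrable_integrand hz μ zero_le_one) (Set.left_mem_uIcc)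
    have := (hc 0 Set.left_mem_uIcc).tendsto
    rw [intervalIntegral.integral_same, Set.uIcc_of_le zero_le_one] at this
    refine this.mono_left ?_
    rw [nhdsWithin_Icc_eq_nhdsGE zero_lt_one]
    exact nhdsWithin_mono _ Set.Ioi_subset_Ici_self
  have h2 : Tendsto (fun h : ℝ => Complex.exp (z * h)) (𝓝[>] 0) (𝓝 1) := by
    have : Continuous (fun h : ℝ => Complex.exp (z * h)) := by fun_prop
    simpa using (this.tendsto 0).mono_left nhdsWithin_le_nhds
  have h3 := h2.smul (h1.const_sub (S.R z μ))
  rw [sub_zero, one_smul] at h3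
  refine h3.congr' ?_
  filter_upwards [self_mem_nhdsWithin] with t ht
  rw [S.T_R_apply hz (le_of_lt ht)]

/-- The first resolvent identity. -/
lemma R_sub_R (S : BoundedSemigroup B) {z a : ℂ} (hz : 0 < z.re) (ha : 0 < a.re) :
    S.R z - S.R a = (a - z) • (S.R z * S.R a) := by
  ext μ
  -- The generator at `R(z) R(a) μ = R(a) R(z) μ` is computed in two ways.
  have h1 := S.tendsto_slope_R hz (S.tendsto_T_R ha μ)
  have h2 := S.tendsto_slope_R ha (S.tendsto_T_R hz μ)
  rw [← S.R_R_apply_comm hz ha] at h2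
  have h3 := tendsto_nhds_unique h1 h2
  change S.R z μ - S.R a μ = (a - z) • S.R z (S.R a μ)
  rw [sub_smul]
  linear_combination (norm := module) h3

lemma R_gen (S : BoundedSemigroup B) {z : ℂ} (hz : 0 < z.re) {μ : B} (h : μ ∈ S.genDom) :
    S.R z (S.gen μ) = z • S.R z μ - μ := by
  refine tendsto_nhds_unique ?_ (S.tendsto_slope_R hz (S.tendsto_T_of_mem_genDom h))
  refine (((S.R z).continuous.tendsto _).comp (S.tendsto_gen h)).congr' ?_
  filter_upwards [self_mem_nhdsWithin] with t ht
  rw [Function.comp, ContinuousLinearMap.map_smul_of_tower, map_sub, S.R_T_apply hz (le_of_lt ht)]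

/-- The finite expansion of `R(z) μ` in negative powers of `z`. -/
lemma R_eq_sum (S : BoundedSemigroup B) {z : ℂ} (hz : 0 < z.re) {μ : B} :
    ∀ {n : ℕ}, μ ∈ S.genPowDom n →
      S.R z μ = ∑ k ∈ Finset.range n, (z⁻¹ ^ (k + 1)) • S.gen^[k] μ
        + (z⁻¹ ^ n) • S.R z (S.gen^[n] μ)
  | 0, _ => by simp
  | n + 1, h => by
    have hz0 : z ≠ 0 := fun h0 => by simp [h0] at hz
    have h1 : S.gen^[n] μ ∈ S.genDom := h n n.lt_succ_self
    have h2 := S.R_gen hz h1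
    rw [R_eq_sum S hz (n := n) fun k hk => h k (hk.trans n.lt_succ_self), Finset.sum_range_succ,
      Function.iterate_succ_apply', h2, add_assoc, smul_sub, smul_smul, pow_succ, mul_assoc,
      inv_mul_cancel₀ hz0, mul_one]
    abel

end BoundedSemigroup

/-- The points `z₀ + x`, `x > 0` small, approach `z₀` from the right half-plane. -/
lemma tendsto_add_ofReal_nhdsGT (z₀ : ℂ) :
    Tendsto (fun x : ℝ => z₀ + x) (𝓝[>] 0) (𝓝 z₀) := by
  have : Continuous fun x : ℝ => z₀ + (x : ℂ) := by fun_prop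
  simpa using (this.tendsto 0).mono_left nhdsWithin_le_nhds

/-! ### Growth bounds and simple poles -/

section SimplePole

variable {E : Type*} [NormedAddCommGroup E] [NormedSpace ℂ E]

lemma AnalyticAt.dslope_self {G : ℂ → E} {z₀ : ℂ} (hG : AnalyticAt ℂ G z₀) :
    AnalyticAt ℂ (dslope G z₀) z₀ :=
  let ⟨_, hp⟩ := hG; ⟨_, hp.has_fpower_series_dslope_fslope⟩

/-- A function on the right half-plane of size at most `C / Re z` has only simple poles on the
imaginary axis. -/
lemma exists_eq_inv_smul_add_of_pow_smul_eq {r : ℂ → E} {z₀ : ℂ} (hz₀ : z₀.re = 0) {C : ℝ}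
    (hr : ∀ z : ℂ, 0 < z.re → ‖r z‖ ≤ C / z.re) (n : ℕ) {G : ℂ → E} (hG : AnalyticAt ℂ G z₀)
    (h : ∀ᶠ z in 𝓝 z₀, 0 < z.re → (z - z₀) ^ (n + 1) • r z = G z) :
    ∃ (a : E) (H : ℂ → E), AnalyticAt ℂ H z₀ ∧
      ∀ᶠ z in 𝓝 z₀, 0 < z.re → r z = (z - z₀)⁻¹ • a + H z := by
  have hne : ∀ z : ℂ, 0 < z.re → z - z₀ ≠ 0 := by
    rintro z hz h0
    rw [sub_eq_zero] at h0
    rw [h0, hz₀] at hz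
    exact lt_irrefl _ hz
  induction n generalizing G with
  | zero =>
    refine ⟨G z₀, dslope G z₀, hG.dslope_self, ?_⟩
    filter_upwards [h] with z hz hre
    have h1 := hz hre
    rw [zero_add, pow_one] at h1
    have h2 := sub_smul_dslope G z₀ z
    rw [← h1] at h2
    calc r z = (z - z₀)⁻¹ • ((z - z₀) • r z) := by rw [smul_smul, inv_mul_cancel₀ (hne z hre), one_smul]
      _ = (z - z₀)⁻¹ • (G z₀ + (z - z₀) • dslope G z₀ z) := by rw [h2]; congr 1; abel
      _ = _ := by rw [smul_add, smul_smul, inv_mul_cancel₀ (hne z hre), one_smul]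
  | succ n ih =>
    -- Along `z₀ + x` the growth bound gives `‖G‖ ≤ x^(n+2) * (C / x) → 0`; the zero of `G` is
    -- divided out, lowering the order of the pole.
    have hG0 : G z₀ = 0 := by
      have h1 : Tendsto (fun x : ℝ => G (z₀ + x)) (𝓝[>] 0) (𝓝 (G z₀)) :=
        hG.continuousAt.tendsto.comp (tendsto_add_ofReal_nhdsGT z₀)
      have h2 : Tendsto (fun x : ℝ => x ^ (n + 1) * C) (𝓝[>] 0) (𝓝 0) := by
        have : Continuous fun x : ℝ => x ^ (n + 1) * C := by fun_prop
        simpa using (this.tendsto 0).mono_left nhdsWithin_le_nhds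
      refine tendsto_nhds_unique h1 (squeeze_zero_norm' ?_ h2)
      filter_upwards [(tendsto_add_ofReal_nhdsGT z₀).eventually h, self_mem_nhdsWithin] with x hx hx0
      have hx0' : 0 < x := hx0
      have hre : (z₀ + (x : ℂ)).re = x := by simp [hz₀]
      rw [← hx (by rw [hre]; exact hx0), norm_smul, norm_pow, add_sub_cancel_left,
        Complex.norm_real, Real.norm_of_nonneg hx0'.le]
      calc x ^ (n + 1 + 1) * ‖r (z₀ + x)‖ ≤ x ^ (n + 1 + 1) * (C / x) := by
            gcongr
            simpa [hre] using hr (z₀ + x) (by rw [hre]; exact hx0)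
        _ = x ^ (n + 1) * C := by field_simp; ring
    refine ih hG.dslope_self ?_
    filter_upwards [h] with z hz hre
    have h1 := hz hre
    have h2 := sub_smul_dslope G z₀ z
    rw [← h1, hG0, sub_zero, pow_succ', mul_smul] at h2
    exact (smul_right_injective E (hne z hre) h2).symm

/-- Reads the residue off from inside the right half-plane, the only place where `R` is given by its
integral; residues are thereby unique. -/
lemma tendsto_smul_of_eq_inv_smul_add {r : ℂ → E} {z₀ : ℂ} (hz₀ : z₀.re = 0) {a : E} {H : ℂ → E}
    (hH : ContinuousAt H z₀) (h : ∀ᶠ z in 𝓝 z₀, 0 < z.re → r z = (z - z₀)⁻¹ • a + H z) :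
    Tendsto (fun x : ℝ => (x : ℂ) • r (z₀ + x)) (𝓝[>] 0) (𝓝 a) := by
  have h0 : Tendsto (fun x : ℝ => (x : ℂ)) (𝓝[>] 0) (𝓝 0) := by
    simpa using (Complex.continuous_ofReal.tendsto 0).mono_left nhdsWithin_le_nhds
  have h1 : Tendsto (fun x : ℝ => a + (x : ℂ) • H (z₀ + x)) (𝓝[>] 0) (𝓝 a) := by
    simpa using (h0.smul (hH.tendsto.comp (tendsto_add_ofReal_nhdsGT z₀))).const_add a
  refine h1.congr' ?_
  filter_upwards [(tendsto_add_ofReal_nhdsGT z₀).eventually h, self_mem_nhdsWithin] with x hx hx0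
  have hx0' : (x : ℂ) ≠ 0 := Complex.ofReal_ne_zero.2 (ne_of_gt hx0)
  rw [hx (by simpa [hz₀] using hx0), add_sub_cancel_left, smul_add, smul_smul,
    mul_inv_cancel₀ hx0', one_smul]

end SimplePole

/-! ### Spectral projections off the essential spectrum -/

section Spectrum

variable {B : Type*} [NormedAddCommGroup B] [NormedSpace ℂ B] [CompleteSpace B]

/-- Away from the essential spectrum there is a finite-rank spectral projection. -/
lemma exists_projection_of_notMem_essSpectrum {L : B →L[ℂ] B} {w : ℂ} (hw0 : w ≠ 0)
    (hw : w ∉ essSpectrum L) :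
    ∃ P : B →L[ℂ] B, P * P = P ∧ FiniteDimensional ℂ (LinearMap.range P.toLinearMap) ∧
      P * L = L * P ∧ (∃ n : ℕ, (w • 1 - L) ^ n * P = 0) ∧ IsUnit (w • 1 - L * (1 - P)) := by
  by_cases hs : w ∈ spectrum ℂ L
  · have hd : IsDiscreteEigenvalue L w := by
      by_contra h; exact hw ⟨hs, h⟩
    obtain ⟨-, -, P, hP, hfin, hcomm, ⟨n, hn⟩, hbij⟩ := hd
    have hPP : ∀ x, P (P x) = P x := fun x => DFunLike.congr_fun hP x
    have hPL : ∀ x, P (L x) = L (P x) := fun x => DFunLike.congr_fun hcomm x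
    refine ⟨P, hP, hfin, hcomm, ⟨n, ?_⟩, ?_⟩
    · ext x
      exact hn (P x) (hPP x)
    -- The operator is `w` on the range of `P` and `w - L` on its kernel, and is bijective on each.
    · rw [ContinuousLinearMap.isUnit_iff_bijective]
      have happ : ∀ x, (w • (1 : B →L[ℂ] B) - L * (1 - P)) x = w • x - L (x - P x) := fun x => rfl
      constructor
      · rw [injective_iff_map_eq_zero]
        intro x hx
        rw [happ] at hx
        have h1 : P x = 0 := by
          have := congrArg P hx
          rw [map_sub, map_smul, hPL, map_sub, hPP, sub_self, map_zero, map_zero, sub_zero] at this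
          exact (smul_eq_zero.1 this).resolve_left hw0
        rw [h1, sub_zero] at hx
        exact hbij.injOn h1 (map_zero P) (by simpa using hx)
      · intro y
        obtain ⟨v, hv, hvy⟩ := hbij.surjOn (show y - P y ∈ {μ | P μ = 0} by
          simp [hPP])
        have hv' : P v = 0 := hv
        refine ⟨w⁻¹ • P y + v, ?_⟩
        have hvy' : w • v - L v = y - P y := hvy
        rw [happ, map_add, map_smul, hPP, hv', smul_add, smul_smul, mul_inv_cancel₀ hw0, one_smul,
          add_zero, add_sub_cancel_left, add_sub_assoc, hvy']
        abel
  · refine ⟨0, by simp, ?_, by simp, ⟨0, by simp⟩, ?_⟩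
    · rw [ContinuousLinearMap.toLinearMap_zero, LinearMap.range_zero]
      infer_instance
    · rw [spectrum.notMem_iff, Algebra.algebraMap_eq_smul_one] at hs
      simpa using hs

end Spectrum

/-! ### Poles of the Laplace transform on the imaginary axis -/

namespace BoundedSemigroup

variable {B : Type*} [NormedAddCommGroup B] [NormedSpace ℂ B]

/-- The residue at a point of the imaginary axis is the limit of `x R(z₀ + x)` as `x → 0+`; it
vanishes where `R` has an extension continuous along the region of rapid mixing. -/
lemma tendsto_smul_R_of_rapid {S : BoundedSemigroup B} {β c : ℝ}
    {F : ℂ → B →L[ℂ] B} (hFR : ∀ z ∈ rapidRegion β c, 0 < z.re → F z = S.R z)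
    (hF : DifferentiableOn ℂ F (rapidRegion β c)) {z₀ : ℂ} (hz₀ : z₀.re = 0) (hβ : β ≤ |z₀.im|) :
    Tendsto (fun x : ℝ => (x : ℂ) • S.R (z₀ + x)) (𝓝[>] 0) (𝓝 0) := by
  have hmem : ∀ x : ℝ, 0 ≤ x → z₀ + x ∈ rapidRegion β c := fun x hx => by
    refine ⟨by simpa using hβ, ?_⟩
    have : 0 ≤ |(z₀ + x).im| ^ (-c) := by positivity
    simp only [Complex.add_re, hz₀, Complex.ofReal_re, zero_add]
    linarith
  have h0 : Tendsto (fun x : ℝ => (x : ℂ)) (𝓝[>] 0) (𝓝 0) := by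
    simpa using (Complex.continuous_ofReal.tendsto 0).mono_left nhdsWithin_le_nhds
  have h1 : Tendsto (fun x : ℝ => F (z₀ + x)) (𝓝[>] 0) (𝓝 (F z₀)) := by
    refine (hF.continuousOn z₀ (by simpa using hmem 0 le_rfl)).tendsto.comp ?_
    refine tendsto_nhdsWithin_of_tendsto_nhds_of_eventually_within _
      (tendsto_add_ofReal_nhdsGT z₀) ?_
    filter_upwards [self_mem_nhdsWithin] with x hx using hmem x (le_of_lt hx)
  have h2 := h0.smul h1
  rw [zero_smul] at h2
  refine h2.congr' ?_
  filter_upwards [self_mem_nhdsWithin] with x hx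
  rw [hFR _ (hmem x (le_of_lt hx)) (by simpa [hz₀] using hx)]

variable [CompleteSpace B]

/-- The resolvent identity, arranged to express `R(z)` through the resolvent of the single operator
`R(a)` at `(a - z)⁻¹`, without assuming that this resolvent exists. -/
lemma R_mul_resolvent (S : BoundedSemigroup B) {z a : ℂ} (hz : 0 < z.re) (ha : 0 < a.re)
    (hza : a - z ≠ 0) :
    S.R z * ((a - z)⁻¹ • 1 - S.R a) = (a - z)⁻¹ • S.R a := by
  have h1 : S.R z * S.R a = (a - z)⁻¹ • (S.R z - S.R a) := by
    rw [S.R_sub_R hz ha, smul_smul, inv_mul_cancel₀ hza, one_smul]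
  rw [mul_sub, h1, mul_smul_comm, mul_one, smul_sub, sub_sub_cancel]

/-- Structure of the Laplace transform at a point `z₀` of the imaginary axis, from a discrete
eigenvalue `(a - z₀)⁻¹` of `R(a)`. -/
lemma exists_simple_pole_of_notMem_essSpectrum (S : BoundedSemigroup B) {z₀ a : ℂ}
    (hz₀ : z₀.re = 0) (ha : 0 < a.re) (hess : (a - z₀)⁻¹ ∉ essSpectrum (S.R a)) :
    ∃ (Q : B →L[ℂ] B) (H : ℂ → B →L[ℂ] B), AnalyticAt ℂ H z₀ ∧
      (∀ᶠ z in 𝓝 z₀, 0 < z.re → S.R z = (z - z₀)⁻¹ • Q + H z) ∧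
      Q * Q = Q ∧ FiniteDimensional ℂ (LinearMap.range Q.toLinearMap) := by
  have haz₀ : a - z₀ ≠ 0 := by
    intro h
    rw [sub_eq_zero] at h
    rw [h, hz₀] at ha
    exact lt_irrefl _ ha
  obtain ⟨P, hP, hfin, hcomm, ⟨n, hn⟩, hunit⟩ :=
    exists_projection_of_notMem_essSpectrum (inv_ne_zero haz₀) hess
  set L := S.R a with hL
  set w₀ := (a - z₀)⁻¹ with hw₀
  have hne : ∀ᶠ z in 𝓝 z₀, a - z ≠ 0 :=
    (continuousAt_const.sub continuousAt_id).eventually_ne haz₀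
  have hwan : AnalyticAt ℂ (fun z : ℂ => (a - z)⁻¹) z₀ :=
    (analyticAt_const.sub analyticAt_id).inv haz₀
  -- the part on the kernel of the projection
  set reg : ℂ → B →L[ℂ] B := fun z =>
    (a - z)⁻¹ • (L * (1 - P) * Ring.inverse ((a - z)⁻¹ • 1 - L * (1 - P))) with hreg
  have hUan : AnalyticAt ℂ (fun z : ℂ => (a - z)⁻¹ • (1 : B →L[ℂ] B) - L * (1 - P)) z₀ :=
    (hwan.smul analyticAt_const).sub analyticAt_const
  have hregan : AnalyticAt ℂ reg z₀ := by
    have h1 : AnalyticAt ℂ Ring.inverse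
        ((fun z : ℂ => (a - z)⁻¹ • (1 : B →L[ℂ] B) - L * (1 - P)) z₀) := by
      obtain ⟨u, hu⟩ := hunit
      change AnalyticAt ℂ Ring.inverse (w₀ • (1 : B →L[ℂ] B) - L * (1 - P))
      rw [← hu]
      exact analyticAt_inverse u
    exact hwan.smul (analyticAt_const.mul
      (h1.comp (f := fun z : ℂ => (a - z)⁻¹ • (1 : B →L[ℂ] B) - L * (1 - P)) hUan))
  have hUev : ∀ᶠ z in 𝓝 z₀, IsUnit ((a - z)⁻¹ • (1 : B →L[ℂ] B) - L * (1 - P)) :=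
    hUan.continuousAt.eventually (Units.isOpen.mem_nhds hunit)
  have hcommQ : (1 - P) * L = L * (1 - P) := by rw [sub_mul, mul_sub, hcomm, one_mul, mul_one]
  have hQQ : (1 - P) * (1 - P) = 1 - P := by
    rw [mul_sub, sub_mul _ _ P, hP, mul_one, one_mul, sub_self, sub_zero]
  have hregeq : ∀ᶠ z in 𝓝 z₀, 0 < z.re → S.R z * (1 - P) = reg z := by
    filter_upwards [hne, hUev] with z h1 h2 hz
    have h3 := S.R_mul_resolvent hz ha h1
    have h4 : S.R z * (1 - P) * ((a - z)⁻¹ • 1 - L * (1 - P)) = (a - z)⁻¹ • (L * (1 - P)) := by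
      rw [mul_assoc, mul_sub (1 - P), ← mul_assoc (1 - P) L, hcommQ, mul_assoc L, hQQ,
        mul_smul_comm, mul_one,
        show (a - z)⁻¹ • (1 - P) - L * (1 - P) = ((a - z)⁻¹ • 1 - L) * (1 - P) by
          rw [sub_mul, smul_mul_assoc, one_mul], ← mul_assoc, h3, smul_mul_assoc]
    rw [hreg]
    simp only
    rw [← smul_mul_assoc, ← h4, mul_assoc _ _ (Ring.inverse _), Ring.mul_inverse_cancel _ h2, mul_one]
  -- the part on the range of the projection
  set sing : ℂ → B →L[ℂ] B := fun z =>
    (a - z)⁻¹ • (L * (∑ i ∈ Finset.range n,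
      (((a - z)⁻¹ - w₀) • (1 : B →L[ℂ] B)) ^ i * (-(w₀ • 1 - L)) ^ (n - 1 - i)) * P) with hsing
  have hsingan : AnalyticAt ℂ sing z₀ := by
    refine hwan.smul ((analyticAt_const.mul ?_).mul analyticAt_const)
    refine Finset.analyticAt_fun_sum _ fun i _ => ?_
    exact (((hwan.sub analyticAt_const).smul analyticAt_const).pow i).mul analyticAt_const
  have hsingeq : ∀ᶠ z in 𝓝 z₀, 0 < z.re →
      ((a - z)⁻¹ - w₀) ^ n • (S.R z * P) = sing z := by
    filter_upwards [hne] with z h1 hz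
    have h3 := S.R_mul_resolvent hz ha h1
    have hc : Commute ((((a - z)⁻¹ - w₀)) • (1 : B →L[ℂ] B)) (-(w₀ • 1 - L)) :=
      (Commute.one_left _).smul_left _
    -- With `w = (a - z)⁻¹`, the difference of `n`-th powers of `w - w₀` and `L - w₀` is divisible
    -- by `w - L`, and the second power vanishes on the range of `P`.
    have h5 := hc.mul_geom_sum₂ n
    rw [sub_neg_eq_add, sub_smul, sub_add_sub_cancel, ← sub_smul] at h5
    have h6 : (-(w₀ • 1 - L)) ^ n * P = 0 := by
      rw [neg_pow, mul_assoc, hn, mul_zero]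
    have h7 := congrArg (fun X => S.R z * (X * P)) h5
    rw [sub_mul _ _ P, h6, sub_zero, ← mul_assoc, ← mul_assoc, h3, smul_mul_assoc, smul_mul_assoc] at h7
    rw [hsing]
    simp only
    rw [h7, smul_pow, one_pow, smul_mul_assoc, one_mul, mul_smul_comm]
  obtain ⟨C, hC⟩ := S.exists_norm_R_le
  -- The pole has order at most `n`; the spare factor `z - z₀` covers `n = 0`.
  have hkey : ∀ᶠ z in 𝓝 z₀, 0 < z.re → (z - z₀) ^ (n + 1) • S.R z
      = (z - z₀) • (((z - z₀) ^ n) • reg z + ((a - z) * (a - z₀)) ^ n • sing z) := by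
    filter_upwards [hne, hregeq, hsingeq] with z h1 h2 h3 hz
    have h4 : (a - z)⁻¹ - w₀ = (z - z₀) / ((a - z) * (a - z₀)) := by
      rw [hw₀]; field_simp; ring
    rw [← h2 hz, ← h3 hz, smul_smul, ← mul_pow, h4, mul_div_cancel₀ _ (mul_ne_zero h1 haz₀),
      ← smul_add, ← mul_add, sub_add_cancel, mul_one, smul_smul, pow_succ']
  obtain ⟨Q, H, hH, hHe⟩ := exists_eq_inv_smul_add_of_pow_smul_eq hz₀ hC n
    (G := fun z => (z - z₀) • (((z - z₀) ^ n) • reg z + ((a - z) * (a - z₀)) ^ n • sing z))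
    (by
      have hid : AnalyticAt ℂ (fun z : ℂ => z - z₀) z₀ := analyticAt_id.sub analyticAt_const
      have hpr : AnalyticAt ℂ (fun z : ℂ => ((a - z) * (a - z₀)) ^ n) z₀ :=
        ((analyticAt_const.sub analyticAt_id).mul analyticAt_const).pow n
      exact hid.smul (((hid.pow n).smul hregan).add (hpr.smul hsingan))) hkey
  have hlim := tendsto_smul_of_eq_inv_smul_add hz₀ hH.continuousAt hHe
  refine ⟨Q, H, hH, hHe, ?_, ?_⟩
  -- Idempotence: the resolvent identity between `z₀ + x` and `z₀ + 2x`, multiplied by `2x`, tends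
  -- to `Q * Q = 2Q - Q`.
  · have htwo : Tendsto (fun x : ℝ => 2 * x) (𝓝[>] 0) (𝓝[>] 0) := by
      refine tendsto_nhdsWithin_of_tendsto_nhds_of_eventually_within _ ?_ ?_
      · have : Continuous fun x : ℝ => 2 * x := by fun_prop
        simpa using (this.tendsto 0).mono_left nhdsWithin_le_nhds
      · filter_upwards [self_mem_nhdsWithin] with x hx
        exact mul_pos (two_pos (α := ℝ)) (Set.mem_Ioi.1 hx)
    have hlim2 := hlim.comp htwo
    have h1 := hlim.mul hlim2
    have h2 := (hlim.const_smul (2 : ℂ)).sub hlim2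
    rw [two_smul, add_sub_cancel_right] at h2
    refine tendsto_nhds_unique (h1.congr' ?_) h2
    filter_upwards [self_mem_nhdsWithin] with x hx
    have hx0 : 0 < x := hx
    have hres := S.R_sub_R (z := z₀ + x) (a := z₀ + ((2 * x : ℝ) : ℂ)) (by simpa [hz₀] using hx0)
      (by simpa [hz₀] using hx0)
    rw [add_sub_add_left_eq_sub, show (((2 * x : ℝ) : ℂ) - x) = x by push_cast; ring] at hres
    simp only [Function.comp]
    rw [smul_mul_smul_comm, mul_comm, mul_smul, ← hres, smul_sub, smul_smul]
    push_cast
    rfl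
  -- Since `R(z) (1 - P)` stays bounded near `z₀`, the residue factors through `P`, which has finite
  -- rank.
  · have hQP : Q * (1 - P) = 0 := by
      have h1 := hlim.mul_const (1 - P)
      have h0 : Tendsto (fun x : ℝ => (x : ℂ)) (𝓝[>] 0) (𝓝 0) := by
        simpa using (Complex.continuous_ofReal.tendsto 0).mono_left nhdsWithin_le_nhds
      have h2 := h0.smul (hregan.continuousAt.tendsto.comp (tendsto_add_ofReal_nhdsGT z₀))
      rw [zero_smul] at h2
      refine tendsto_nhds_unique (h1.congr' ?_) h2
      filter_upwards [(tendsto_add_ofReal_nhdsGT z₀).eventually hregeq, self_mem_nhdsWithin]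
        with x hx hx0
      rw [smul_mul_assoc, hx (by simpa [hz₀] using hx0)]
      rfl
    rw [mul_sub, mul_one, sub_eq_zero] at hQP
    rw [hQP]
    change FiniteDimensional ℂ (LinearMap.range (Q.toLinearMap ∘ₗ P.toLinearMap))
    rw [LinearMap.range_comp]
    infer_instance

lemma LasotaYorke.exists_simple_pole {S : BoundedSemigroup B} {lam : ℝ} (hlam : 0 < lam)
    (h : S.LasotaYorke lam) {z₀ : ℂ} (hz₀ : z₀.re = 0) :
    ∃ (Q : B →L[ℂ] B) (H : ℂ → B →L[ℂ] B), AnalyticAt ℂ H z₀ ∧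
      (∀ᶠ z in 𝓝 z₀, 0 < z.re → S.R z = (z - z₀)⁻¹ • Q + H z) ∧
      Q * Q = Q ∧ FiniteDimensional ℂ (LinearMap.range Q.toLinearMap) := by
  -- Chosen so that `a² + (Im z₀)² < (a + lam)²`, that is `|a - z₀|⁻¹ > (a + lam)⁻¹`.
  set a : ℝ := z₀.im ^ 2 / (2 * lam) + 1 with ha
  have ha0 : 0 < a := by positivity
  refine S.exists_simple_pole_of_notMem_essSpectrum (a := a) hz₀ (by simpa using ha0) fun hmem => ?_
  have h1 : (‖((a : ℂ) - z₀)⁻¹‖₊ : ℝ≥0∞) ≤ ENNReal.ofReal ((a + lam)⁻¹) :=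
    (le_iSup₂ (f := fun η (_ : η ∈ essSpectrum (S.R a)) => (‖η‖₊ : ℝ≥0∞)) _ hmem).trans
      (by have := h a (by simpa using ha0); rwa [Complex.ofReal_re] at this)
  have hnorm : ‖(a : ℂ) - z₀‖ ^ 2 = a ^ 2 + z₀.im ^ 2 := by
    rw [← Complex.normSq_eq_norm_sq, Complex.normSq_apply]
    simp [hz₀]; ring
  have hpos : 0 < ‖(a : ℂ) - z₀‖ := by
    by_contra hcon
    have : ‖(a : ℂ) - z₀‖ = 0 := le_antisymm (not_lt.1 hcon) (norm_nonneg _)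
    rw [this] at hnorm
    nlinarith [sq_nonneg z₀.im, sq_pos_of_pos ha0]
  rw [← enorm_eq_nnnorm, ← ofReal_norm] at h1
  rw [norm_inv, ENNReal.ofReal_le_ofReal_iff (by positivity),
    inv_le_inv₀ hpos (by positivity)] at h1
  have h2 : z₀.im ^ 2 = (a - 1) * (2 * lam) := by
    rw [ha]; field_simp; ring
  nlinarith [pow_le_pow_left₀ (by positivity) h1 2]

/-- The poles on the imaginary axis are finite in number; their principal parts removed, the
Laplace transform extends analytically across the axis. -/
lemma exists_finite_principal_parts {S : BoundedSemigroup B} {lam β : ℝ} (hlam : 0 < lam)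
    (hLY : S.LasotaYorke lam)
    (hvan : ∀ z₀ : ℂ, z₀.re = 0 → β ≤ |z₀.im| →
      Tendsto (fun x : ℝ => (x : ℂ) • S.R (z₀ + x)) (𝓝[>] 0) (𝓝 0)) :
    ∃ (N : ℕ) (z : Fin N → ℂ) (Q : Fin N → B →L[ℂ] B), Function.Injective z ∧
      (∀ j, (z j).re = 0 ∧ |(z j).im| ≤ β) ∧
      (∀ j, Q j * Q j = Q j ∧ FiniteDimensional ℂ (LinearMap.range (Q j).toLinearMap)) ∧
      ∀ z₀ : ℂ, z₀.re = 0 → ∃ H : ℂ → B →L[ℂ] B, AnalyticAt ℂ H z₀ ∧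
        ∀ᶠ w in 𝓝 z₀, 0 < w.re → S.R w - ∑ j, (w - z j)⁻¹ • Q j = H w := by
  have hpole : ∀ y : ℝ, ∃ (Q : B →L[ℂ] B) (H : ℂ → B →L[ℂ] B), AnalyticAt ℂ H (y * Complex.I) ∧
      (∀ᶠ z in 𝓝 (y * Complex.I), 0 < z.re → S.R z = (z - y * Complex.I)⁻¹ • Q + H z) ∧
      Q * Q = Q ∧ FiniteDimensional ℂ (LinearMap.range Q.toLinearMap) :=
    fun y => hLY.exists_simple_pole hlam (by simp)
  choose Q H hH hR hQ hfin using hpole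
  have hlim : ∀ y : ℝ, Tendsto (fun x : ℝ => (x : ℂ) • S.R (y * Complex.I + x)) (𝓝[>] 0) (𝓝 (Q y)) :=
    fun y => tendsto_smul_of_eq_inv_smul_add (by simp) (hH y).continuousAt (hR y)
  have hext : ∀ (y : ℝ) (K : ℂ → B →L[ℂ] B), ContinuousAt K (y * Complex.I) →
      (∀ᶠ z in 𝓝 (y * Complex.I), 0 < z.re → S.R z = K z) → Q y = 0 := by
    intro y K hK hKe
    refine tendsto_nhds_unique (hlim y)
      (tendsto_smul_of_eq_inv_smul_add (H := K) (by simp) hK ?_)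
    filter_upwards [hKe] with z hz h
    rw [smul_zero, zero_add, hz h]
  have hcont : Continuous fun y : ℝ => (y : ℂ) * Complex.I := by fun_prop
  -- The expansion at `y` is continuous at every other nearby point of the axis, so the residue
  -- there is zero.
  have hiso : ∀ y : ℝ, ∀ᶠ y' in 𝓝[≠] y, Q y' = 0 := by
    intro y
    have h1 := (hcont.tendsto y).eventually ((hR y).eventually_nhds.and (hH y).eventually_analyticAt)
    filter_upwards [h1.filter_mono nhdsWithin_le_nhds, self_mem_nhdsWithin] with y' hy' hne
    have hne' : (y' : ℂ) * Complex.I - y * Complex.I ≠ 0 := by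
      rw [← sub_mul, ← Complex.ofReal_sub]
      exact mul_ne_zero (Complex.ofReal_ne_zero.2 (sub_ne_zero.2 hne)) Complex.I_ne_zero
    refine hext y' (fun z => (z - y * Complex.I)⁻¹ • Q y + H y z) ?_ hy'.1
    exact (((continuousAt_id.sub continuousAt_const).inv₀ hne').smul continuousAt_const).add
      hy'.2.continuousAt
  have hzero : ∀ y : ℝ, β ≤ |y| → Q y = 0 := fun y hy =>
    tendsto_nhds_unique (hlim y) (hvan _ (by simp) (by simpa using hy))
  have hJ : {y : ℝ | Q y ≠ 0}.Finite := by
    by_contra hinf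
    have hsub : {y : ℝ | Q y ≠ 0} ⊆ Set.Icc (-β) β := fun y hy => by
      rw [Set.mem_Icc, ← abs_le]
      by_contra hcon
      exact hy (hzero y (le_of_lt (not_le.1 hcon)))
    obtain ⟨y, -, hy⟩ := Set.Infinite.exists_accPt_of_subset_isCompact hinf isCompact_Icc hsub
    rw [accPt_iff_frequently_nhdsNE] at hy
    exact hy ((hiso y).mono fun y' h h' => h' h)
  set s := hJ.toFinset with hs
  let e := s.equivFin.symm
  have hsum : ∀ w : ℂ, ∑ j, (w - (e j : ℝ) * Complex.I)⁻¹ • Q (e j)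
      = ∑ y ∈ s, (w - y * Complex.I)⁻¹ • Q y := fun w => by
    rw [e.sum_comp (fun y : s => (w - (y : ℝ) * Complex.I)⁻¹ • Q y)]
    exact Finset.sum_coe_sort s fun y : ℝ => (w - y * Complex.I)⁻¹ • Q y
  refine ⟨s.card, fun j => (e j : ℝ) * Complex.I, fun j => Q (e j), ?_, ?_, ?_, ?_⟩
  · intro i j hij
    have h1 : ((e i : ℝ) : ℂ) = (e j : ℝ) := mul_right_cancel₀ Complex.I_ne_zero hij
    exact e.injective (Subtype.ext (Complex.ofReal_injective h1))
  · intro j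
    refine ⟨by simp, ?_⟩
    have h1 : Q (e j) ≠ 0 := hJ.mem_toFinset.1 (e j).2
    by_contra hcon
    exact h1 (hzero _ (by simpa using le_of_lt (not_le.1 hcon)))
  · exact fun j => ⟨hQ _, hfin _⟩
  · intro z₀ hz₀
    have hz : z₀ = z₀.im * Complex.I := by
      apply Complex.ext <;> simp [hz₀]
    obtain ⟨y, rfl⟩ : ∃ y : ℝ, z₀ = y * Complex.I := ⟨_, hz⟩
    refine ⟨fun w => H y w - ∑ y' ∈ s.erase y, (w - y' * Complex.I)⁻¹ • Q y', ?_, ?_⟩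
    · refine (hH y).sub (Finset.analyticAt_fun_sum _ fun y' hy' => ?_)
      refine ((analyticAt_id.sub analyticAt_const).inv ?_).smul analyticAt_const
      change (y : ℂ) * Complex.I - y' * Complex.I ≠ 0
      rw [← sub_mul, ← Complex.ofReal_sub]
      exact mul_ne_zero (Complex.ofReal_ne_zero.2 (sub_ne_zero.2 (Finset.ne_of_mem_erase hy').symm))
        Complex.I_ne_zero
    · filter_upwards [hR y] with w hw hre
      rw [hsum, hw hre]
      by_cases hy : y ∈ s
      · rw [← Finset.add_sum_erase s _ hy]
        abel
      · have h0 : Q y = 0 := by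
          by_contra h; exact hy (hJ.mem_toFinset.2 h)
        rw [Finset.erase_eq_of_notMem hy, h0, smul_zero, zero_add]

end BoundedSemigroup

/-! ### Differentiation and inversion of Laplace transforms -/

section Laplace

variable {E : Type*} [NormedAddCommGroup E] [NormedSpace ℂ E]

lemma integrableOn_pow_mul_exp_neg_mul (p : ℕ) {a : ℝ} (ha : 0 < a) (M : ℝ) :
    IntegrableOn (fun t : ℝ => t ^ p * Real.exp (-a * t) * M) (Set.Ioi 0) := by
  have h := integrableOn_rpow_mul_exp_neg_mul_rpow (p := 1) (s := p) (b := a)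
    (by linarith [(Nat.cast_nonneg p : (0 : ℝ) ≤ p)]) one_pos ha
  simp only [Real.rpow_natCast, Real.rpow_one] at h
  exact Integrable.mul_const h M

lemma norm_laplace_integrand_le {f : ℝ → E} {M : ℝ} (hM : ∀ t, 0 < t → ‖f t‖ ≤ M) (p : ℕ) {z : ℂ}
    {a : ℝ} (haz : a ≤ z.re) {t : ℝ} (ht : 0 < t) :
    ‖((-(t : ℂ)) ^ p * Complex.exp (-z * t)) • f t‖ ≤ t ^ p * Real.exp (-a * t) * M := by
  rw [norm_smul, norm_mul, norm_pow, norm_neg, Complex.norm_real, Real.norm_of_nonneg ht.le,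
    Complex.norm_exp]
  have h1 : (-z * (t : ℂ)).re = -z.re * t := by simp
  rw [h1]
  have h2 : Real.exp (-z.re * t) ≤ Real.exp (-a * t) := by
    gcongr
  gcongr
  exact hM t ht

lemma aestronglyMeasurable_laplace_integrand {f : ℝ → E}
    (hf : AEStronglyMeasurable f (volume.restrict (Set.Ioi 0))) (p : ℕ) (z : ℂ) :
    AEStronglyMeasurable (fun t : ℝ => ((-(t : ℂ)) ^ p * Complex.exp (-z * t)) • f t)
      (volume.restrict (Set.Ioi 0)) :=
  (Continuous.aestronglyMeasurable (by fun_prop)).smul hf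

lemma integrableOn_laplace_integrand {f : ℝ → E}
    (hf : AEStronglyMeasurable f (volume.restrict (Set.Ioi 0))) {M : ℝ}
    (hM : ∀ t, 0 < t → ‖f t‖ ≤ M) (p : ℕ) {z : ℂ} (hz : 0 < z.re) :
    IntegrableOn (fun t : ℝ => ((-(t : ℂ)) ^ p * Complex.exp (-z * t)) • f t) (Set.Ioi 0) := by
  refine (integrableOn_pow_mul_exp_neg_mul p hz M).mono'
    (aestronglyMeasurable_laplace_integrand hf p z) ?_
  filter_upwards [ae_restrict_mem measurableSet_Ioi] with t ht
  exact norm_laplace_integrand_le hM p le_rfl ht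

lemma hasDerivAt_laplace {f : ℝ → E}
    (hf : AEStronglyMeasurable f (volume.restrict (Set.Ioi 0))) {M : ℝ}
    (hM : ∀ t, 0 < t → ‖f t‖ ≤ M) (p : ℕ) {z : ℂ} (hz : 0 < z.re) :
    HasDerivAt (fun z : ℂ => ∫ t in Set.Ioi (0 : ℝ), ((-(t : ℂ)) ^ p * Complex.exp (-z * t)) • f t)
      (∫ t in Set.Ioi (0 : ℝ), ((-(t : ℂ)) ^ (p + 1) * Complex.exp (-z * t)) • f t) z := by
  -- Halving the abscissa leaves one integrable majorant for all nearby `w`.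
  have hs : {w : ℂ | z.re / 2 < w.re} ∈ 𝓝 z :=
    (isOpen_lt continuous_const Complex.continuous_re).mem_nhds (by simpa using hz)
  refine (hasDerivAt_integral_of_dominated_loc_of_deriv_le hs
    (Eventually.of_forall fun w => aestronglyMeasurable_laplace_integrand hf p w)
    (integrableOn_laplace_integrand hf hM p hz)
    (F' := fun w t => ((-(t : ℂ)) ^ (p + 1) * Complex.exp (-w * t)) • f t)
    (aestronglyMeasurable_laplace_integrand hf (p + 1) z) ?_
    (integrableOn_pow_mul_exp_neg_mul (p + 1) (half_pos hz) M) ?_).2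
  · filter_upwards [ae_restrict_mem measurableSet_Ioi] with t ht w hw
    exact norm_laplace_integrand_le hM (p + 1) (le_of_lt hw) ht
  · refine Eventually.of_forall fun t w _ => ?_
    have h1 : HasDerivAt (fun w : ℂ => -w * (t : ℂ)) (-(t : ℂ)) w := by
      simpa using (hasDerivAt_id w).neg.mul_const (t : ℂ)
    have h2 := (h1.cexp.const_mul ((-(t : ℂ)) ^ p)).smul_const (f t)
    convert h2 using 2
    ring

lemma iteratedDeriv_laplace {f : ℝ → E}
    (hf : AEStronglyMeasurable f (volume.restrict (Set.Ioi 0))) {M : ℝ}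
    (hM : ∀ t, 0 < t → ‖f t‖ ≤ M) (p : ℕ) {z : ℂ} (hz : 0 < z.re) :
    iteratedDeriv p (fun z : ℂ => ∫ t in Set.Ioi (0 : ℝ), Complex.exp (-z * t) • f t) z
      = ∫ t in Set.Ioi (0 : ℝ), ((-(t : ℂ)) ^ p * Complex.exp (-z * t)) • f t := by
  induction p generalizing z with
  | zero => simp
  | succ p ih =>
    rw [iteratedDeriv_succ]
    have he : iteratedDeriv p (fun z : ℂ => ∫ t in Set.Ioi (0 : ℝ), Complex.exp (-z * t) • f t)
        =ᶠ[𝓝 z] fun z => ∫ t in Set.Ioi (0 : ℝ), ((-(t : ℂ)) ^ p * Complex.exp (-z * t)) • f t := by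
      filter_upwards [(isOpen_lt continuous_const Complex.continuous_re).mem_nhds hz] with w hw
      exact ih hw
    rw [he.deriv_eq, (hasDerivAt_laplace hf hM p hz).deriv]

open FourierTransform in
/-- A bound on the `p`-th derivative of the Laplace transform along a vertical line gives, by
Fourier inversion, a pointwise bound on the function. -/
lemma norm_le_of_laplace_bound [CompleteSpace E] {f : ℝ → E} (hf : ContinuousOn f (Set.Ici 0))
    {M : ℝ} (hM : ∀ t, 0 ≤ t → ‖f t‖ ≤ M) {p : ℕ} (hp : p ≠ 0) {a K : ℝ} (ha : 0 < a)
    (hK : ∀ y : ℝ, ‖∫ t in Set.Ioi (0 : ℝ),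
      ((-(t : ℂ)) ^ p * Complex.exp (-(a + y * Complex.I) * t)) • f t‖ ≤ K / (1 + y ^ 2))
    {t : ℝ} (ht : 0 ≤ t) : t ^ p * Real.exp (-a * t) * ‖f t‖ ≤ K * Real.pi := by
  have hfm : AEStronglyMeasurable f (volume.restrict (Set.Ioi 0)) :=
    (hf.mono Set.Ioi_subset_Ici_self).aestronglyMeasurable measurableSet_Ioi
  have hM' : ∀ t, 0 < t → ‖f t‖ ≤ M := fun t ht => hM t ht.le
  set φ : ℝ → E := fun t => ((-(t : ℂ)) ^ p * Complex.exp (-(a : ℂ) * t)) • f t with hφ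
  -- Since `p ≠ 0`, `φ` vanishes at `0`: this is the extension of `φ` by zero, and it is continuous,
  -- so Fourier inversion holds at every point.
  set g : ℝ → E := fun v => φ (max v 0) with hg
  have hgind : g = (Set.Ioi 0).indicator φ := by
    ext v
    by_cases hv : 0 < v
    · rw [Set.indicator_of_mem (Set.mem_Ioi.2 hv), hg]
      simp only [max_eq_left hv.le]
    · rw [Set.indicator_of_notMem (by simpa using hv), hg]
      simp only [max_eq_right (not_lt.1 hv), hφ]
      simp [hp]
  have hgc : Continuous g := by
    have h1 : Continuous fun v : ℝ => f (max v 0) :=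
      hf.comp_continuous (by fun_prop) fun v => Set.mem_Ici.2 (le_max_right v 0)
    have h2 : Continuous fun v : ℝ =>
        (-((max v 0 : ℝ) : ℂ)) ^ p * Complex.exp (-(a : ℂ) * ((max v 0 : ℝ) : ℂ)) := by
      have : Continuous fun v : ℝ => ((max v 0 : ℝ) : ℂ) :=
        Complex.continuous_ofReal.comp (by fun_prop)
      fun_prop
    exact h2.smul h1
  have hgi : Integrable g := by
    rw [hgind, integrable_indicator_iff measurableSet_Ioi]
    exact integrableOn_laplace_integrand hfm hM' p (by simpa using ha)
  have hFg : ∀ ξ : ℝ, 𝓕 g ξ = ∫ t in Set.Ioi (0 : ℝ),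
      ((-(t : ℂ)) ^ p * Complex.exp (-(a + ((2 * Real.pi * ξ : ℝ) : ℂ) * Complex.I) * t)) • f t := by
    intro ξ
    rw [Real.fourier_real_eq_integral_exp_smul, hgind, ← integral_indicator measurableSet_Ioi]
    congr 1
    ext v
    by_cases hv : v ∈ Set.Ioi (0 : ℝ)
    · rw [Set.indicator_of_mem hv, Set.indicator_of_mem hv]
      simp only [hφ, smul_smul]
      rw [mul_left_comm, ← Complex.exp_add]
      congr 3
      push_cast; ring
    · rw [Set.indicator_of_notMem hv, Set.indicator_of_notMem hv, smul_zero]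
  have hFb : ∀ ξ : ℝ, ‖𝓕 g ξ‖ ≤ K * (1 + ξ ^ 2)⁻¹ := by
    intro ξ
    have hK0 : 0 ≤ K := by simpa using (norm_nonneg _).trans (hK 0)
    rw [hFg]
    refine (hK _).trans ?_
    rw [div_eq_mul_inv]
    have h1 : (1 : ℝ) ≤ 2 * Real.pi := by linarith [Real.pi_gt_three]
    have h2 : ξ ^ 2 ≤ (2 * Real.pi * ξ) ^ 2 := by
      rw [mul_pow]
      exact le_mul_of_one_le_left (sq_nonneg ξ) (one_le_pow₀ h1)
    gcongr
  have hFc : Continuous (𝓕 g) :=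
    VectorFourier.fourierIntegral_continuous Real.continuous_fourierChar
      (by exact continuous_inner) hgi
  have hFi : Integrable (𝓕 g) :=
    (integrable_inv_one_add_sq.const_mul K).mono' hFc.aestronglyMeasurable (Eventually.of_forall hFb)
  have hinv := congrFun (hgc.fourierInv_fourier_eq hgi hFi) t
  have hnorm : ‖g t‖ ≤ K * Real.pi := by
    have hpi : K * Real.pi = ∫ ξ : ℝ, K * (1 + ξ ^ 2)⁻¹ := by
      rw [integral_const_mul, integral_univ_inv_one_add_sq]
    rw [← hinv, Real.fourierInv_eq', hpi]
    refine norm_integral_le_of_norm_le (integrable_inv_one_add_sq.const_mul K)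
      (Eventually.of_forall fun ξ => ?_)
    rw [norm_smul, Complex.norm_exp_ofReal_mul_I, one_mul]
    exact hFb ξ
  have hgt : ‖g t‖ = t ^ p * Real.exp (-a * t) * ‖f t‖ := by
    rw [hg]
    simp only [max_eq_left ht, hφ]
    rw [norm_smul, norm_mul, norm_pow, norm_neg, Complex.norm_real, Real.norm_of_nonneg ht,
      Complex.norm_exp]
    simp
  rwa [← hgt]

end Laplace

/-! ### Cauchy estimates -/

lemma abs_im_sub_le_of_mem_closedBall {z w : ℂ} {r : ℝ} (hw : w ∈ Metric.closedBall z r) :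
    |z.im| - r ≤ |w.im| ∧ |w.im| ≤ |z.im| + r := by
  have h1 : |w.im - z.im| ≤ r := by
    rw [← Complex.sub_im]
    exact (Complex.abs_im_le_norm _).trans (by simpa [dist_eq_norm] using hw)
  have h2 := abs_abs_sub_abs_le_abs_sub w.im z.im
  have h3 := abs_le.1 (h2.trans h1)
  constructor <;> linarith [h3.1, h3.2]

section Cauchy

variable {E : Type*} [NormedAddCommGroup E] [NormedSpace ℂ E] [CompleteSpace E]

lemma norm_iteratedDeriv_add_le {p : ℕ} {z : ℂ} {f g : ℂ → E} (hf : AnalyticAt ℂ f z)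
    (hg : AnalyticAt ℂ g z) : ‖iteratedDeriv p (fun w => f w + g w) z‖
      ≤ ‖iteratedDeriv p f z‖ + ‖iteratedDeriv p g z‖ := by
  have h1 := hf.contDiffAt (n := p)
  have h2 := hg.contDiffAt (n := p)
  rw [iteratedDeriv_fun_add h1 h2]
  exact norm_add_le _ _

lemma norm_iteratedDeriv_sum_le {κ : Type*} (s : Finset κ) {p : ℕ} {z : ℂ} {f : κ → ℂ → E}
    (hf : ∀ i ∈ s, AnalyticAt ℂ (f i) z) : ‖iteratedDeriv p (fun w => ∑ i ∈ s, f i w) z‖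
      ≤ ∑ i ∈ s, ‖iteratedDeriv p (f i) z‖ := by
  rw [iteratedDeriv_fun_sum fun i hi => (hf i hi).contDiffAt]
  exact norm_sum_le _ _

lemma norm_iteratedDeriv_le_of_closedBall {f : ℂ → E} {z : ℂ} {r C : ℝ} (p : ℕ)
    (hr : 0 < r) (hf : DifferentiableOn ℂ f (Metric.closedBall z r))
    (hC : ∀ w ∈ Metric.closedBall z r, ‖f w‖ ≤ C) :
    ‖iteratedDeriv p f z‖ ≤ p.factorial * C / r ^ p :=
  Complex.norm_iteratedDeriv_le_of_forall_mem_sphere_norm_le p hr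
    (hf.diffContOnCl_ball subset_rfl) fun w hw => hC w (Metric.sphere_subset_closedBall hw)

/-- On the disc of radius `|Im z| / 4` the function is `O(1 / |Im z|)`, and Cauchy's estimate gains
a further factor `4 / |Im z|` as soon as `p ≥ 1`. Without a derivative, `1 / |Im z|` would not be
integrable along a vertical line. -/
lemma norm_iteratedDeriv_inv_pow_smul_le {β : ℝ} {b z : ℂ} (hb : |b.im| ≤ β)
    (hz : 2 * β + 4 ≤ |z.im|) {p : ℕ} (hp : p ≠ 0) (k : ℕ) (v : E) :
    ‖iteratedDeriv p (fun w => ((w - b)⁻¹ ^ (k + 1)) • v) z‖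
      ≤ 16 * p.factorial * ‖v‖ / |z.im| ^ 2 := by
  have hβ : 0 ≤ β := (abs_nonneg _).trans hb
  set y := |z.im| with hy
  have hy0 : 0 < y := by linarith
  have hdist : ∀ w ∈ Metric.closedBall z (y / 4), y / 4 ≤ ‖w - b‖ := by
    intro w hw
    have h1 := (abs_im_sub_le_of_mem_closedBall hw).1
    have h2 : |w.im| - |b.im| ≤ ‖w - b‖ :=
      (abs_sub_abs_le_abs_sub _ _).trans (by rw [← Complex.sub_im]; exact Complex.abs_im_le_norm _)
    linarith
  have hle : ∀ w ∈ Metric.closedBall z (y / 4), ‖((w - b)⁻¹ ^ (k + 1)) • v‖ ≤ (4 / y) * ‖v‖ := by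
    intro w hw
    have h1 : ‖(w - b)⁻¹‖ ≤ 4 / y := by
      rw [norm_inv, ← inv_div]
      exact inv_anti₀ (by positivity) (hdist w hw)
    have h2 : 4 / y ≤ 1 := by rw [div_le_one hy0]; linarith
    rw [norm_smul, norm_pow]
    gcongr
    calc ‖(w - b)⁻¹‖ ^ (k + 1) ≤ ‖(w - b)⁻¹‖ ^ 1 :=
          pow_le_pow_of_le_one (norm_nonneg _) (h1.trans h2) (by omega)
      _ ≤ 4 / y := by rwa [pow_one]
  have hd : DifferentiableOn ℂ (fun w => ((w - b)⁻¹ ^ (k + 1)) • v) (Metric.closedBall z (y / 4)) := by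
    intro w hw
    have hne : w - b ≠ 0 := by
      rw [← norm_pos_iff]; exact lt_of_lt_of_le (by positivity) (hdist w hw)
    exact ((((differentiableAt_id.sub_const b).inv hne).pow (k + 1)).smul_const v).differentiableWithinAt
  refine (norm_iteratedDeriv_le_of_closedBall p (by positivity) hd hle).trans ?_
  have h3 : y / 4 ≤ (y / 4) ^ p := le_self_pow₀ (by linarith) hp
  calc p.factorial * (4 / y * ‖v‖) / (y / 4) ^ p ≤ p.factorial * (4 / y * ‖v‖) / (y / 4) := by
        gcongr
    _ = 16 * p.factorial * ‖v‖ / y ^ 2 := by field_simp; ring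

end Cauchy

/-! ### Bounds on the regular part, and decay of the remainder -/

namespace BoundedSemigroup

section Bounds

variable {B : Type*} [NormedAddCommGroup B] [NormedSpace ℂ B]

lemma norm_gen_iterate_le_genPowNorm (S : BoundedSemigroup B) {q k : ℕ} (hk : k ≤ q) (μ : B) :
    ‖S.gen^[k] μ‖ ≤ S.genPowNorm q μ :=
  Finset.single_le_sum (f := fun k => ‖S.gen^[k] μ‖) (fun _ _ => norm_nonneg _)
    (Finset.mem_range.2 (Nat.lt_succ_of_le hk))

lemma norm_le_genPowNorm (S : BoundedSemigroup B) (q : ℕ) (μ : B) : ‖μ‖ ≤ S.genPowNorm q μ :=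
  S.norm_gen_iterate_le_genPowNorm (Nat.zero_le q) μ

lemma genPowNorm_nonneg (S : BoundedSemigroup B) (q : ℕ) (μ : B) : 0 ≤ S.genPowNorm q μ :=
  (norm_nonneg _).trans (S.norm_le_genPowNorm q μ)

/-- The semigroup without its imaginary poles stays bounded. -/
lemma exists_norm_sub_sum_le (S : BoundedSemigroup B) {N : ℕ} {z : Fin N → ℂ}
    {Q : Fin N → B →L[ℂ] B} (hz : ∀ j, (z j).re = 0) :
    ∃ D : ℝ, 0 < D ∧ ∀ t : ℝ, 0 ≤ t → ‖S.T t - ∑ j, Complex.exp ((t : ℂ) * z j) • Q j‖ ≤ D := by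
  obtain ⟨D, hD, hDb⟩ := S.bounded
  refine ⟨D + ∑ j, ‖Q j‖, add_pos_of_pos_of_nonneg hD (by positivity), fun t ht => ?_⟩
  refine (norm_sub_le _ _).trans (add_le_add (hDb t ht) ((norm_sum_le _ _).trans ?_))
  refine Finset.sum_le_sum fun j _ => ?_
  rw [norm_smul, Complex.norm_exp]
  simp [hz j]

end Bounds

/-- In the disc `|Im w| ≤ 2 |Im z|`, so the region extends left of the axis at least as far as the
radius. The radius does not depend on `Re z`, hence the later bounds are uniform up to the axis. -/
lemma closedBall_subset_rapidRegion {β c : ℝ} (hβ : 0 < β) (hc : 0 < c) {z : ℂ} (hz : 0 < z.re)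
    (hy : 2 * β + 4 ≤ |z.im|) :
    Metric.closedBall z ((2 * |z.im|) ^ (-c)) ⊆ rapidRegion β c ∧ (2 * |z.im|) ^ (-c) ≤ 1 := by
  have hr1 : (2 * |z.im|) ^ (-c) ≤ 1 :=
    Real.rpow_le_one_of_one_le_of_nonpos (by linarith) (by linarith)
  refine ⟨fun w hw => ?_, hr1⟩
  obtain ⟨h1, h2⟩ := abs_im_sub_le_of_mem_closedBall hw
  refine ⟨by linarith, ?_⟩
  have h3 : |w.re - z.re| ≤ (2 * |z.im|) ^ (-c) := by
    rw [← Complex.sub_re]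
    exact (Complex.abs_re_le_norm _).trans (by simpa [dist_eq_norm] using hw)
  have h4 : (2 * |z.im|) ^ (-c) ≤ |w.im| ^ (-c) :=
    Real.rpow_le_rpow_of_nonpos (by linarith) (by linarith) (by linarith)
  linarith [(abs_le.1 h3).1]

variable {B : Type*} [NormedAddCommGroup B] [NormedSpace ℂ B] [CompleteSpace B]

/-- With `y = |Im z|`, the growth of `F` costs `(2y)^c'` and Cauchy's estimate on a disc of radius
`(2y)^(-c)` costs `(2y)^(c p)`. The factor `w⁻ⁿ` pays for both and leaves `y⁻²`; this fixes how many
powers of the generator are needed. -/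
lemma norm_iteratedDeriv_inv_pow_smul_rapid_le {β c c' C : ℝ} (hβ : 0 < β) (hc : 0 < c)
    (hc' : 0 < c') (hC : 0 < C) {F : ℂ → B →L[ℂ] B}
    (hF : DifferentiableOn ℂ F (rapidRegion β c))
    (hFb : ∀ z ∈ rapidRegion β c, ‖F z‖ ≤ C * |z.im| ^ c') {p n : ℕ} (hn : c' + c * p + 2 ≤ n)
    {z : ℂ} (hz : 0 < z.re) (hy : 2 * β + 4 ≤ |z.im|) (ν : B) :
    AnalyticAt ℂ (fun w => w⁻¹ ^ n • F w ν) z ∧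
    ‖iteratedDeriv p (fun w => w⁻¹ ^ n • F w ν) z‖
      ≤ p.factorial * (C * 4 ^ n) * ‖ν‖ / |z.im| ^ 2 := by
  obtain ⟨hsub, hr1⟩ := closedBall_subset_rapidRegion hβ hc hz hy
  set y := |z.im| with hyd
  have hy0 : 0 < y := by linarith
  set r := (2 * y) ^ (-c) with hr
  have hr0 : 0 < r := by positivity
  have him : ∀ w ∈ Metric.closedBall z r, y / 2 ≤ |w.im| ∧ |w.im| ≤ 2 * y := fun w hw => by
    obtain ⟨h1, h2⟩ := abs_im_sub_le_of_mem_closedBall hw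
    constructor <;> linarith
  have hd : DifferentiableOn ℂ (fun w => w⁻¹ ^ n • F w ν) (Metric.closedBall z r) := by
    intro w hw
    have hw0 : w ≠ 0 := by
      rintro rfl
      have := (him 0 hw).1
      simp only [Complex.zero_im, abs_zero] at this
      linarith
    have h1 : DifferentiableWithinAt ℂ (fun w => F w ν) (Metric.closedBall z r) w :=
      ((hF w (hsub hw)).mono hsub).clm_apply (differentiableWithinAt_const ν)
    exact (((differentiableAt_id.inv hw0).pow n).differentiableWithinAt).smul h1
  refine ⟨hd.analyticAt (Metric.closedBall_mem_nhds z hr0), ?_⟩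
  have hb : ∀ w ∈ Metric.closedBall z r,
      ‖w⁻¹ ^ n • F w ν‖ ≤ (2 / y) ^ n * (C * (2 * y) ^ c' * ‖ν‖) := by
    intro w hw
    obtain ⟨h1, h2⟩ := him w hw
    have h3 : ‖w⁻¹‖ ≤ 2 / y := by
      rw [norm_inv, ← inv_div]
      exact inv_anti₀ (by positivity) (h1.trans (Complex.abs_im_le_norm w))
    rw [norm_smul, norm_pow]
    have h4 : ‖F w ν‖ ≤ C * (2 * y) ^ c' * ‖ν‖ := by
      refine (F w).le_of_opNorm_le ((hFb w (hsub hw)).trans ?_) ν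
      gcongr
    gcongr
  refine (norm_iteratedDeriv_le_of_closedBall p hr0 hd hb).trans ?_
  have hrp : (r ^ p)⁻¹ = (2 * y) ^ (c * p) := by
    rw [hr, ← Real.rpow_natCast, ← Real.rpow_mul (by positivity), ← Real.rpow_neg (by positivity)]
    congr 1; ring
  have hpow : (2 * y) ^ c' * (2 * y) ^ (c * p) ≤ (2 * y) ^ n / (2 * y) ^ 2 := by
    rw [← Real.rpow_add (by positivity), ← Real.rpow_natCast, ← Real.rpow_natCast,
      ← Real.rpow_sub (by positivity)]
    refine Real.rpow_le_rpow_of_exponent_le (by linarith) ?_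
    push_cast; linarith
  calc p.factorial * ((2 / y) ^ n * (C * (2 * y) ^ c' * ‖ν‖)) / r ^ p
      = p.factorial * ((2 / y) ^ n * C * ‖ν‖) * ((2 * y) ^ c' * (2 * y) ^ (c * p)) := by
        rw [div_eq_mul_inv, hrp]; ring
    _ ≤ p.factorial * ((2 / y) ^ n * C * ‖ν‖) * ((2 * y) ^ n / (2 * y) ^ 2) := by gcongr
    _ = p.factorial * (C * 4 ^ n) * ‖ν‖ / (4 * y ^ 2) := by
        have : (2 / y) ^ n * (2 * y) ^ n = 4 ^ n := by
          rw [← mul_pow]; congr 1; field_simp; norm_num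
        rw [← this]; ring
    _ ≤ p.factorial * (C * 4 ^ n) * ‖ν‖ / y ^ 2 := by
        gcongr
        nlinarith [sq_nonneg y]

/-- The Laplace transform of `μ` with the principal parts `(w - z j)⁻¹ Q j` removed. -/
def regularPart (S : BoundedSemigroup B) {N : ℕ} (z : Fin N → ℂ) (Q : Fin N → B →L[ℂ] B) (μ : B)
    (w : ℂ) : B :=
  S.R w μ - ∑ j, (w - z j)⁻¹ • Q j μ

variable {S : BoundedSemigroup B} {N : ℕ} {z : Fin N → ℂ} {Q : Fin N → B →L[ℂ] B}

/-- Near a bounded piece of the imaginary axis the derivatives of the regular part are bounded. -/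
lemma exists_norm_iteratedDeriv_regularPart_le
    (hreg : ∀ z₀ : ℂ, z₀.re = 0 → ∃ H : ℂ → B →L[ℂ] B, AnalyticAt ℂ H z₀ ∧
        ∀ᶠ w in 𝓝 z₀, 0 < w.re → S.R w - ∑ j, (w - z j)⁻¹ • Q j = H w) (p : ℕ) (M : ℝ) :
    ∃ K δ : ℝ, 0 ≤ K ∧ 0 < δ ∧ ∀ y ∈ Set.Icc (-M) M, ∀ x : ℝ, 0 < x → x < δ → ∀ μ : B,
      ‖iteratedDeriv p (S.regularPart z Q μ) (x + y * Complex.I)‖ ≤ K * ‖μ‖ := by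
  refine (isCompact_Icc (a := -M) (b := M)).induction_on
    (p := fun s : Set ℝ => ∃ K δ : ℝ, 0 ≤ K ∧ 0 < δ ∧ ∀ y ∈ s, ∀ x : ℝ, 0 < x → x < δ → ∀ μ : B,
      ‖iteratedDeriv p (S.regularPart z Q μ) (x + y * Complex.I)‖ ≤ K * ‖μ‖) ?_ ?_ ?_ ?_
  · exact ⟨0, 1, le_rfl, one_pos, fun y hy => absurd hy (Set.notMem_empty y)⟩
  · rintro s t hst ⟨K, δ, hK, hδ, h⟩
    exact ⟨K, δ, hK, hδ, fun y hy => h y (hst hy)⟩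
  · rintro s t ⟨K, δ, hK, hδ, h⟩ ⟨K', δ', hK', hδ', h'⟩
    refine ⟨max K K', min δ δ', le_max_of_le_left hK, lt_min hδ hδ', ?_⟩
    rintro y (hy | hy) x hx hxδ μ
    · exact (h y hy x hx (hxδ.trans_le (min_le_left _ _)) μ).trans (by gcongr; exact le_max_left _ _)
    · exact (h' y hy x hx (hxδ.trans_le (min_le_right _ _)) μ).trans
        (by gcongr; exact le_max_right _ _)
  · intro y₀ _
    obtain ⟨H, hH, hHe⟩ := hreg (y₀ * Complex.I) (by simp)
    have hb : ∀ᶠ w in 𝓝 ((y₀ : ℂ) * Complex.I), ‖H w‖ ≤ ‖H (y₀ * Complex.I)‖ + 1 :=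
      (hH.continuousAt.norm.eventually_lt_const (lt_add_one _)).mono fun _ h => h.le
    obtain ⟨ε, hε, hball⟩ := Metric.eventually_nhds_iff_ball.1
      (hHe.and (hH.eventually_analyticAt.and hb))
    set K := ‖H (y₀ * Complex.I)‖ + 1 with hK
    have hK0 : 0 ≤ K := by positivity
    refine ⟨{y | |y - y₀| < ε / 4}, mem_nhdsWithin_of_mem_nhds ?_, p.factorial * K / (ε / 2) ^ p,
      ε / 4, by positivity, by positivity, ?_⟩
    · exact Metric.ball_mem_nhds y₀ (by positivity)
    intro y hy x hx hxε μ
    set ζ : ℂ := x + y * Complex.I with hζ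
    have hdist : dist ζ (y₀ * Complex.I) < ε / 2 := by
      have h1 : ζ - y₀ * Complex.I = x + ((y - y₀ : ℝ) : ℂ) * Complex.I := by
        rw [hζ]; push_cast; ring
      have hy' : |y - y₀| < ε / 4 := hy
      rw [dist_eq_norm, h1]
      refine (norm_add_le _ _).trans_lt ?_
      rw [norm_mul, Complex.norm_I, mul_one, Complex.norm_real, Complex.norm_real,
        Real.norm_of_nonneg hx.le, Real.norm_eq_abs]
      linarith
    have hsub : Metric.closedBall ζ (ε / 2) ⊆ Metric.ball (y₀ * Complex.I) ε := by
      intro w hw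
      rw [Metric.mem_ball]
      have := dist_triangle w ζ (y₀ * Complex.I)
      linarith [Metric.mem_closedBall.1 hw]
    have heq : S.regularPart z Q μ =ᶠ[𝓝 ζ] fun w => H w μ := by
      have hre : 0 < ζ.re := by simpa [hζ] using hx
      filter_upwards [(isOpen_lt continuous_const Complex.continuous_re).mem_nhds hre,
        Metric.isOpen_ball.mem_nhds (hsub (Metric.mem_closedBall_self (by positivity)))] with w hw hwb
      rw [← (hball w hwb).1 hw]
      simp [regularPart]
    rw [heq.iteratedDeriv_eq]
    refine (norm_iteratedDeriv_le_of_closedBall (r := ε / 2) (C := K * ‖μ‖) p (by positivity) ?_ ?_).trans ?_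
    · intro w hw
      exact ((hball w (hsub hw)).2.1.differentiableAt.clm_apply
        (differentiableAt_const μ)).differentiableWithinAt
    · exact fun w hw => (H w).le_of_opNorm_le (hball w (hsub hw)).2.2 μ
    · exact le_of_eq (by ring)

/-- Decay of the derivatives of the regular part at large imaginary parts. -/
lemma norm_iteratedDeriv_regularPart_le_of_rapid {β c c' C : ℝ} (hβ : 0 < β) (hc : 0 < c)
    (hc' : 0 < c') (hC : 0 < C) {F : ℂ → B →L[ℂ] B}
    (hFR : ∀ z ∈ rapidRegion β c, 0 < z.re → F z = S.R z)
    (hF : DifferentiableOn ℂ F (rapidRegion β c))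
    (hFb : ∀ z ∈ rapidRegion β c, ‖F z‖ ≤ C * |z.im| ^ c') (hz : ∀ j, |(z j).im| ≤ β)
    {p n : ℕ} (hp : p ≠ 0) (hn : c' + c * p + 2 ≤ n) {μ : B} (hμ : μ ∈ S.genPowDom n)
    {ζ : ℂ} (hζ : 0 < ζ.re) (hy : 2 * β + 4 ≤ |ζ.im|) :
    ‖iteratedDeriv p (S.regularPart z Q μ) ζ‖
      ≤ (n * (16 * p.factorial) + p.factorial * (C * 4 ^ n) + ∑ j, 16 * p.factorial * ‖Q j‖)
        * S.genPowNorm n μ / |ζ.im| ^ 2 := by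
  have hy0 : 0 < |ζ.im| := by linarith
  obtain ⟨hsub, -⟩ := closedBall_subset_rapidRegion hβ hc hζ hy
  -- Writing `w - 0` and `0 + 1` lets one Cauchy estimate serve both the powers of `w⁻¹` and the
  -- principal parts.
  have heq : S.regularPart z Q μ =ᶠ[𝓝 ζ] fun w =>
      ((∑ k ∈ Finset.range n, ((w - 0)⁻¹ ^ (k + 1)) • S.gen^[k] μ)
        + w⁻¹ ^ n • F w (S.gen^[n] μ)) + ∑ j, ((w - z j)⁻¹ ^ (0 + 1)) • (-(Q j μ)) := by
    filter_upwards [(isOpen_lt continuous_const Complex.continuous_re).mem_nhds hζ,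
      Metric.closedBall_mem_nhds ζ (ε := (2 * |ζ.im|) ^ (-c)) (by positivity)] with w hw hwb
    rw [regularPart, S.R_eq_sum hw hμ, hFR w (hsub hwb) hw]
    simp [sub_eq_add_neg]
  have hinv : ∀ (b : ℂ) (k : ℕ) (v : B), |b.im| ≤ β →
      AnalyticAt ℂ (fun w => ((w - b)⁻¹ ^ (k + 1)) • v) ζ := by
    intro b k v hb
    have hne : ζ - b ≠ 0 := by
      intro h
      rw [sub_eq_zero] at h
      rw [h] at hy
      linarith
    exact (((analyticAt_id.sub analyticAt_const).inv hne).pow (k + 1)).smul analyticAt_const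
  have h0 : |(0 : ℂ).im| ≤ β := by simpa using hβ.le
  obtain ⟨hFan, hFle⟩ := norm_iteratedDeriv_inv_pow_smul_rapid_le hβ hc hc' hC hF hFb hn hζ hy
    (S.gen^[n] μ)
  have hsum1 : AnalyticAt ℂ
      (fun w => ∑ k ∈ Finset.range n, ((w - 0)⁻¹ ^ (k + 1)) • S.gen^[k] μ) ζ :=
    Finset.analyticAt_fun_sum _ fun k _ => hinv 0 k _ h0
  have hsum2 : AnalyticAt ℂ (fun w => ∑ j, ((w - z j)⁻¹ ^ (0 + 1)) • (-(Q j μ))) ζ :=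
    Finset.analyticAt_fun_sum _ fun j _ => hinv (z j) 0 _ (hz j)
  rw [heq.iteratedDeriv_eq]
  refine (norm_iteratedDeriv_add_le (hsum1.add hFan) hsum2).trans ?_
  refine (add_le_add (norm_iteratedDeriv_add_le hsum1 hFan) le_rfl).trans ?_
  set G := S.genPowNorm n μ with hG
  have hG0 : 0 ≤ G := S.genPowNorm_nonneg n μ
  have e1 : ‖iteratedDeriv p
      (fun w => ∑ k ∈ Finset.range n, ((w - 0)⁻¹ ^ (k + 1)) • S.gen^[k] μ) ζ‖
      ≤ n * (16 * p.factorial * G / |ζ.im| ^ 2) := by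
    refine (norm_iteratedDeriv_sum_le _ fun k _ => hinv 0 k _ h0).trans ?_
    refine (Finset.sum_le_card_nsmul _ _ (16 * p.factorial * G / |ζ.im| ^ 2) fun k hk => ?_).trans
      (by simp)
    refine (norm_iteratedDeriv_inv_pow_smul_le h0 hy hp k _).trans ?_
    gcongr
    exact S.norm_gen_iterate_le_genPowNorm (Finset.mem_range.1 hk).le μ
  have e2 : ‖iteratedDeriv p (fun w => w⁻¹ ^ n • F w (S.gen^[n] μ)) ζ‖
      ≤ p.factorial * (C * 4 ^ n) * G / |ζ.im| ^ 2 := by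
    refine hFle.trans ?_
    gcongr
    exact S.norm_gen_iterate_le_genPowNorm le_rfl μ
  have e3 : ‖iteratedDeriv p (fun w => ∑ j, ((w - z j)⁻¹ ^ (0 + 1)) • (-(Q j μ))) ζ‖
      ≤ ∑ j, 16 * p.factorial * (‖Q j‖ * G) / |ζ.im| ^ 2 := by
    refine (norm_iteratedDeriv_sum_le _ fun j _ => hinv (z j) 0 _ (hz j)).trans ?_
    refine Finset.sum_le_sum fun j _ => ?_
    refine (norm_iteratedDeriv_inv_pow_smul_le (hz j) hy hp 0 _).trans ?_
    rw [norm_neg]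
    gcongr
    exact ((Q j).le_opNorm μ).trans (by gcongr; exact S.norm_le_genPowNorm n μ)
  refine (add_le_add (add_le_add e1 e2) e3).trans (le_of_eq ?_)
  rw [← Finset.sum_div, add_mul, add_mul, Finset.sum_mul, add_div, add_div]
  congr 2
  · ring
  · exact Finset.sum_congr rfl fun j _ => by ring

lemma integral_exp_mul_exp_smul {z₀ : ℂ} (hz₀ : z₀.re = 0) {w : ℂ} (hw : 0 < w.re) (v : B) :
    Integrable (fun t : ℝ => Complex.exp (-w * t) • Complex.exp (t * z₀) • v)
      (volume.restrict (Set.Ioi 0)) ∧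
    ∫ t in Set.Ioi (0 : ℝ), Complex.exp (-w * t) • Complex.exp (t * z₀) • v = (w - z₀)⁻¹ • v := by
  have h1 : ∀ t : ℝ, Complex.exp (-w * t) • Complex.exp (t * z₀) • v
      = Complex.exp ((z₀ - w) * t) • v := fun t => by
    rw [smul_smul, ← Complex.exp_add]
    congr 2; ring
  have hre : (z₀ - w).re < 0 := by simpa [hz₀] using hw
  simp only [h1]
  constructor
  · exact Integrable.smul_const (integrableOn_exp_mul_complex_Ioi hre 0) v
  · rw [integral_smul_const, integral_exp_mul_complex_Ioi hre]
    simp only [Complex.ofReal_zero, mul_zero, Complex.exp_zero]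
    rw [neg_div, one_div, ← inv_neg, neg_sub]

/-- Each principal part is the Laplace transform of `e^{t z j} Q j μ`. This carries bounds on
`regularPart` over to the remainder in time. -/
lemma integral_sub_sum_eq_regularPart (hz : ∀ j, (z j).re = 0) {w : ℂ} (hw : 0 < w.re) (μ : B) :
    ∫ t in Set.Ioi (0 : ℝ), Complex.exp (-w * t) •
      ((S.T t - ∑ j, Complex.exp ((t : ℂ) * z j) • Q j) μ) = S.regularPart z Q μ w := by
  have h1 : ∀ t : ℝ, Complex.exp (-w * t) • ((S.T t - ∑ j, Complex.exp ((t : ℂ) * z j) • Q j) μ)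
      = S.integrand w μ t
        - ∑ j, Complex.exp (-w * t) • Complex.exp ((t : ℂ) * z j) • Q j μ := fun t => by
    simp [integrand, smul_sub, Finset.smul_sum]
  simp only [h1]
  rw [integral_sub (S.integrable_integrand hw μ)
    (integrable_finsetSum _ fun j _ => (integral_exp_mul_exp_smul (hz j) hw (Q j μ)).1),
    integral_finsetSum _ fun j _ => (integral_exp_mul_exp_smul (hz j) hw (Q j μ)).1, regularPart,
    S.R_apply hw]
  congr 1
  exact Finset.sum_congr rfl fun j _ => (integral_exp_mul_exp_smul (hz j) hw (Q j μ)).2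

/-- Superpolynomial decay, on regular vectors, of the semigroup without its imaginary poles. -/
lemma exists_pow_mul_norm_le (hz : ∀ j, (z j).re = 0) {q : ℕ} {p : ℕ} (hp : p ≠ 0) {K δ : ℝ}
    (hδ : 0 < δ) (hK : ∀ μ ∈ S.genPowDom (q + 1), ∀ x y : ℝ, 0 < x → x < δ →
      ‖iteratedDeriv p (S.regularPart z Q μ) (x + y * Complex.I)‖
        ≤ K * S.genPowNorm (q + 1) μ / (1 + y ^ 2))
    {μ : B} (hμ : μ ∈ S.genPowDom (q + 1)) {t : ℝ} (ht : 0 ≤ t) :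
    t ^ p * ‖(S.T t - ∑ j, Complex.exp ((t : ℂ) * z j) • Q j) μ‖
      ≤ K * Real.pi * S.genPowNorm (q + 1) μ := by
  set f : ℝ → B := fun t => (S.T t - ∑ j, Complex.exp ((t : ℂ) * z j) • Q j) μ with hf
  obtain ⟨D, hD, hDb⟩ := exists_norm_sub_sum_le (Q := Q) S hz
  have hfc : ContinuousOn f (Set.Ici 0) := by
    -- The exponent `q + 1 ≥ 1` puts `μ` in the domain of the generator, which makes its orbit
    -- continuous.
    have h1 := S.continuousOn_T_apply (S.tendsto_T_of_mem_genDom (hμ 0 q.succ_pos))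
    have h2 : Continuous fun t : ℝ => ∑ j, Complex.exp ((t : ℂ) * z j) • Q j μ := by fun_prop
    refine (h1.sub h2.continuousOn).congr fun t _ => ?_
    simp [hf]
  have hfb : ∀ t, 0 ≤ t → ‖f t‖ ≤ D * ‖μ‖ := fun t ht => ContinuousLinearMap.le_of_opNorm_le _ (hDb t ht) μ
  have hfm : AEStronglyMeasurable f (volume.restrict (Set.Ioi 0)) :=
    (hfc.mono Set.Ioi_subset_Ici_self).aestronglyMeasurable measurableSet_Ioi
  -- The right-hand side is independent of `a`, so `a → 0+` removes the exponential weight.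
  have key : ∀ a : ℝ, 0 < a → a < δ →
      t ^ p * Real.exp (-a * t) * ‖f t‖ ≤ K * S.genPowNorm (q + 1) μ * Real.pi := by
    intro a ha haδ
    refine norm_le_of_laplace_bound hfc hfb hp ha (fun y => ?_) ht
    have hre : 0 < ((a : ℂ) + y * Complex.I).re := by simpa using ha
    rw [← iteratedDeriv_laplace hfm (fun t ht => hfb t ht.le) p hre]
    have heq : (fun w : ℂ => ∫ t in Set.Ioi (0 : ℝ), Complex.exp (-w * t) • f t)
        =ᶠ[𝓝 ((a : ℂ) + y * Complex.I)] S.regularPart z Q μ := by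
      filter_upwards [(isOpen_lt continuous_const Complex.continuous_re).mem_nhds hre] with w hw
      exact integral_sub_sum_eq_regularPart hz hw μ
    rw [heq.iteratedDeriv_eq]
    exact hK μ hμ a y ha haδ
  have hlim : Tendsto (fun a : ℝ => t ^ p * Real.exp (-a * t) * ‖f t‖) (𝓝[>] 0)
      (𝓝 (t ^ p * ‖f t‖)) := by
    have : Continuous fun a : ℝ => t ^ p * Real.exp (-a * t) * ‖f t‖ := by fun_prop
    simpa using (this.tendsto 0).mono_left nhdsWithin_le_nhds
  rw [show K * Real.pi * S.genPowNorm (q + 1) μ = K * S.genPowNorm (q + 1) μ * Real.pi by ring]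
  refine le_of_tendsto hlim ?_
  filter_upwards [Ioo_mem_nhdsGT hδ] with a ha
  exact key a ha.1 ha.2

end BoundedSemigroup

end

/-! ### Choice of the constants -/

theorem theorem2
    {A B : Type*}
    [NormedAddCommGroup A] [NormedSpace ℂ A] [CompleteSpace A]
    [NormedAddCommGroup B] [NormedSpace ℂ B] [CompleteSpace B]
    (ι : B →L[ℂ] A) (hι_inj : Function.Injective ι) (hι_le : ∀ μ : B, ‖ι μ‖ ≤ ‖μ‖)
    (S : BoundedSemigroup B)
    (hLip : S.WeakLipschitz ι)
    (lam : ℝ) (hlam : 0 < lam) (hLY : S.LasotaYorke lam)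
    (β : ℝ) (hβ : 0 < β) (hRapid : S.RapidMixing β) :
    ∃ (N : ℕ) (z : Fin N → ℂ) (Pi : Fin N → B →L[ℂ] B) (P : ℝ → B →L[ℂ] B),
      Function.Injective z ∧
      (∀ j, -lam < (z j).re ∧ (z j).re ≤ 0 ∧ |(z j).im| ≤ β) ∧
      (∀ j, Pi j * Pi j = Pi j ∧ FiniteDimensional ℂ (LinearMap.range (Pi j).toLinearMap)) ∧
      (∀ t : ℝ, 0 ≤ t → S.T t = P t + ∑ j, Complex.exp ((t : ℂ) * z j) • Pi j) ∧
      ∀ p : ℕ, ∃ (q : ℕ) (C : ℝ), 0 < C ∧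
        ∀ μ ∈ S.genPowDom q, ∀ t : ℝ, 0 ≤ t →
          t ^ p * ‖ι (P t μ)‖ ≤ C * S.genPowNorm q μ := by
  obtain ⟨C, c', c, hC, hc', hc, F, hFR, hF, hFb⟩ := hRapid
  obtain ⟨N, z, Q, hinj, hz, hQ, hreg⟩ := BoundedSemigroup.exists_finite_principal_parts hlam hLY
    fun z₀ h0 hβ' => BoundedSemigroup.tendsto_smul_R_of_rapid hFR hF h0 hβ'
  refine ⟨N, z, Q, fun t => S.T t - ∑ j, Complex.exp ((t : ℂ) * z j) • Q j, hinj,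
    fun j => ⟨by rw [(hz j).1]; linarith, (hz j).1.le, (hz j).2⟩, hQ,
    fun t _ => (sub_add_cancel _ _).symm, fun p => ?_⟩
  -- Inversion needs `p ≥ 1`; for `p = 0` boundedness of the remainder suffices.
  rcases eq_or_ne p 0 with rfl | hp
  · obtain ⟨D, hD, hDb⟩ := BoundedSemigroup.exists_norm_sub_sum_le (Q := Q) S fun j => (hz j).1
    refine ⟨0, D, hD, fun μ _ t ht => ?_⟩
    rw [pow_zero, one_mul]
    refine (hι_le _).trans ((ContinuousLinearMap.le_of_opNorm_le _ (hDb t ht) μ).trans ?_)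
    gcongr
    exact S.norm_le_genPowNorm 0 μ
  obtain ⟨q, hq⟩ := exists_nat_ge (c' + c * p + 2)
  have hn : c' + c * p + 2 ≤ ((q + 1 : ℕ) : ℝ) := by push_cast; linarith
  set M := 2 * β + 4 with hM
  obtain ⟨K₁, δ, hK₁, hδ, h₁⟩ := BoundedSemigroup.exists_norm_iteratedDeriv_regularPart_le hreg p M
  set K₂ : ℝ := ((q + 1 : ℕ) : ℝ) * (16 * p.factorial) + p.factorial * (C * 4 ^ (q + 1))
    + ∑ j, 16 * p.factorial * ‖Q j‖ with hK₂
  have hK₂0 : 0 ≤ K₂ := by positivity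
  -- The first term serves `|y| ≤ M`, the second `|y| ≥ M`, where `1 + y² ≤ 2y²`; the `1` makes `K`
  -- positive.
  set K : ℝ := K₁ * (1 + M ^ 2) + 2 * K₂ + 1 with hK
  have hbound : ∀ μ ∈ S.genPowDom (q + 1), ∀ x y : ℝ, 0 < x → x < δ →
      ‖iteratedDeriv p (S.regularPart z Q μ) (x + y * Complex.I)‖
        ≤ K * S.genPowNorm (q + 1) μ / (1 + y ^ 2) := by
    intro μ hμ x y hx hxδ
    have hG0 := S.genPowNorm_nonneg (q + 1) μ
    rw [le_div_iff₀ (by positivity)]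
    rcases le_total |y| M with hy | hy
    · have h2 : y ^ 2 ≤ M ^ 2 := sq_le_sq' (abs_le.1 hy).1 (abs_le.1 hy).2
      calc _ ≤ K₁ * S.genPowNorm (q + 1) μ * (1 + M ^ 2) := by
            gcongr
            exact (h₁ y (abs_le.1 hy) x hx hxδ μ).trans
              (by gcongr; exact S.norm_le_genPowNorm (q + 1) μ)
        _ = (K₁ * (1 + M ^ 2)) * S.genPowNorm (q + 1) μ := by ring
        _ ≤ K * S.genPowNorm (q + 1) μ := by
            gcongr
            rw [hK]; linarith
    · have him : ((x : ℂ) + y * Complex.I).im = y := by simp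
      have h2 := BoundedSemigroup.norm_iteratedDeriv_regularPart_le_of_rapid (Q := Q) hβ hc hc' hC
        hFR hF hFb (fun j => (hz j).2) hp hn hμ (ζ := x + y * Complex.I) (by simpa using hx)
        (by rw [him]; exact hy)
      rw [him, sq_abs] at h2
      have hy1 : 1 ≤ y ^ 2 := by
        rw [← sq_abs]; nlinarith
      calc _ ≤ K₂ * S.genPowNorm (q + 1) μ / y ^ 2 * (1 + y ^ 2) := by gcongr
        _ ≤ K₂ * S.genPowNorm (q + 1) μ / y ^ 2 * (2 * y ^ 2) := by gcongr; linarith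
        _ = (2 * K₂) * S.genPowNorm (q + 1) μ := by
            have hy2 : y ^ 2 ≠ 0 := by positivity
            rw [div_mul_eq_mul_div, div_eq_iff hy2]; ring
        _ ≤ K * S.genPowNorm (q + 1) μ := by
            gcongr
            rw [hK]; nlinarith [mul_nonneg hK₁ (by positivity : 0 ≤ 1 + M ^ 2)]
  have hKpos : 0 < K := by rw [hK]; positivity
  refine ⟨q + 1, K * Real.pi, by positivity, fun μ hμ t ht => ?_⟩
  refine le_trans ?_ (BoundedSemigroup.exists_pow_mul_norm_le (fun j => (hz j).1) hp hδ hbound hμ ht)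
  gcongr
  exact hι_le _
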